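/- For a finite abelian group $G$ (written additively), a set $S\subseteq G$ is sum-free if there are no $x,y,z\in S$ (not necessarily distinct) with $x+y=z$. Let $\mu(G)$ be the size of a largest sum-free subset of $G$, and let $f_{\max}(G)$ be the number of sum-free subsets of $G$ that are maximal under inclusion. Call $G$ of type II if $3$ divides $|G|$ and no prime $p\equiv 2 \pmod 3$ divides $|G|$. If $G$ is a finite abelian group of type II whose order is divisible by $9$, then $$f_{\max}(G)=3^{(1/3+o(1))\mu(G)},$$ where $o(1)\to 0$ as $|G|\to\infty$, uniformly over all such $G$. That is, for every $\varepsilon>0$ there is $N$ such that every such $G$ with $|G|\ge N$ satisfies $f_{\max}(G)=3^{(1/3+\delta)\mu(G)}$ for some real $\delta$ with $|\delta|\le\varepsilon$. Consequently it is not true that $f_{\max}(G)\le 2^{(1/2+o(1))\mu(G)}$ for all finite abelian groups $G$: it is not the case that for every $\varepsilon>0$ there is $N$ such that every finite abelian group $G$ with $|G|\ge N$ satisfies $f_{\max}(G)\le 2^{(1/2+\varepsilon)\mu(G)}$. -/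

import Mathlib

universe u

/-- A subset `S` of an additive group is sum-free if it contains no `x, y, z` (not necessarily
distinct) with `x + y = z`, that is, `(S + S) ∩ S = ∅`. -/
def IsSumFree {G : Type u} [AddCommGroup G] (S : Set G) : Prop :=
  ∀ x ∈ S, ∀ y ∈ S, x + y ∉ S

/-- `μ(G)`: the size of a largest sum-free subset of `G` (used for finite `G` only, where the
supremum is over a finite nonempty set of natural numbers). -/
noncomputable def muSumFree (G : Type u) [AddCommGroup G] : ℕ :=
  sSup {k : ℕ | ∃ S : Set G, IsSumFree S ∧ S.ncard = k}

/-- `f_max(G)`: the number of inclusion-maximal sum-free subsets of `G`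
(used for finite `G` only). -/
noncomputable def fMax (G : Type u) [AddCommGroup G] : ℕ :=
  {S : Set G | Maximal IsSumFree S}.ncard

/-- `G` is of type II: its order is divisible by `3`, but by no prime congruent to `2` mod `3`. -/
def IsTypeII (G : Type u) : Prop :=
  3 ∣ Nat.card G ∧ ∀ p : ℕ, p.Prime → p ∣ Nat.card G → p % 3 ≠ 2

/-! ### Removal lemma for Schur triples. -/

namespace SumFree

open Finset SimpleGraph TripartiteFromTriangles Sum3

/-! Upper bound, valid in every finite abelian group: by `exists_containers`, all sum-free sets lie
in exp(o(|G|)) containers with o(|G|²) Schur pairs, and by removal each container `A` becomes a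
sum-free `B` after deleting o(|G|) elements. A maximal sum-free `M ⊆ A` is recovered from `S = M \
B` and `M ∩ B`. Because `B` is sum-free, the only obstructions to adding elements of `B` to `S` come
from single elements and pairs, so `M ∩ B` is a maximal independent set of a graph on part of `B`.
Moon–Moser allows at most 3^(|B|/3) of these, and |B| ≤ μ(G). The total is exp(o(|G|)) · 3^(μ(G)/3)
(`exists_fMax_le`).

In type II, μ(G) = |G|/3, so o(|G|) is o(μ(G)). A fibre of a surjection to ℤ/3 attains this value.
For the upper estimate on μ, a larger sum-free set has so small a sumset that a Mann-type theorem
yields a subgroup to induct on (`three_mul_card_le_of_isSumFree`).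

Lower bound (`three_pow_le_fMax`): if 9 divides |G|, some `s` of order 3 lies in the kernel of that
surjection. The fibre over 1 splits into |G|/9 cosets of ⟨s⟩, which are triangles of the link graph
of {s}, the extremal Moon–Moser configuration. Choosing one point from each gives 3^(|G|/9) =
3^(μ/3) sum-free sets, no two inside one maximal set. Since 3^(1/3) > 2^(1/2), the conjectured bound
fails on cyclic 3-groups. -/

/-- The pairs `(x, y)` in `A × A` with `x + y ∈ A`. -/
def schurPairs {G : Type u} [AddCommGroup G] [DecidableEq G] (A : Finset G) : Finset (G × G) :=
  {p ∈ A ×ˢ A | p.1 + p.2 ∈ A}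

section Removal

variable {G : Type u} [AddCommGroup G] [Fintype G] [DecidableEq G]

/-- Vertices of the triangles `(g, g + x, g + x + y)`, where `x, y, x + y ∈ A`. -/
def schurTriangles (A : Finset G) : Finset (G × G × G) :=
  (univ ×ˢ schurPairs A).image fun q ↦ (q.1, q.1 + q.2.1, q.1 + q.2.1 + q.2.2)

lemma mem_schurTriangles {A : Finset G} {a b c : G} :
    (a, b, c) ∈ schurTriangles A ↔ b - a ∈ A ∧ c - b ∈ A ∧ c - a ∈ A := by
  simp only [schurTriangles, schurPairs, mem_image, mem_product, mem_univ, true_and, mem_filter,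
    Prod.exists, Prod.mk.injEq]
  constructor
  · rintro ⟨a, x, y, ⟨⟨hx, hy⟩, hxy⟩, rfl, rfl, rfl⟩
    refine ⟨by simpa using hx, by simpa using hy, ?_⟩
    rw [add_assoc, add_sub_cancel_left]; exact hxy
  · rintro ⟨h1, h2, h3⟩
    exact ⟨a, b - a, c - b, ⟨⟨h1, h2⟩, by simpa using h3⟩, rfl, by abel, by abel⟩

lemma card_schurTriangles_le (A : Finset G) :
    #(schurTriangles A) ≤ Fintype.card G * #(schurPairs A) := by
  refine card_image_le.trans ?_
  rw [card_product, card_univ]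

/-- Whether an edge is present depends only on the difference of its endpoints lying in `A`, so
three edges found in possibly different Schur triangles still form one. Hence there are no
accidental triangles to count. -/
lemma cliqueFinset_graph_subset (A : Finset G) :
    (graph (schurTriangles A)).cliqueFinset 3 ⊆ (schurTriangles A).image toTriangle := by
  intro s hs
  rw [mem_cliqueFinset_iff, is3Clique_iff] at hs
  obtain ⟨x, y, z, hxy, hxz, hyz, rfl⟩ := hs
  obtain ⟨a, b, c, habc, hab, hac, hbc⟩ := graph_triple hxy hxz hyz
  rw [Graph.in₀₁_iff] at hab
  rw [Graph.in₀₂_iff] at hac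
  rw [Graph.in₁₂_iff] at hbc
  obtain ⟨_, hab⟩ := hab
  obtain ⟨_, hac⟩ := hac
  obtain ⟨_, hbc⟩ := hbc
  rw [mem_schurTriangles] at hab hac hbc
  exact mem_image.2 ⟨(a, b, c), mem_schurTriangles.2 ⟨hab.1, hbc.2.1, hac.2.2⟩, habc⟩

/-- If `x ∈ X` labels at least a third of its possible `|G|` edges in `D`, for every `x`, then
`X` is small. -/
lemma card_mul_card_le_of_label {G : Type*} [Fintype G] {ι : Type*} [DecidableEq ι] (D : Finset ι) (e : G → G → ι)
    (he : Function.Injective fun q : G × G ↦ e q.1 q.2) (X : Finset G)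
    (hX : ∀ x ∈ X, Fintype.card G ≤ 3 * #{g | e x g ∈ D}) :
    Fintype.card G * #X ≤ 3 * #D := by
  have h1 : ∑ x ∈ X, #{g | e x g ∈ D} ≤ #D := by
    rw [← card_sigma]
    refine card_le_card_of_injOn (fun q ↦ e q.1 q.2) ?_ ?_
    · rintro ⟨x, g⟩ h
      simpa using (mem_sigma.1 h).2
    · rintro ⟨x, g⟩ - ⟨y, k⟩ - h
      have := @he (x, g) (y, k) h
      simp only [Prod.mk.injEq] at this
      obtain ⟨rfl, rfl⟩ := this
      rfl
  calc Fintype.card G * #X = ∑ x ∈ X, Fintype.card G := by rw [sum_const, smul_eq_mul, mul_comm]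
    _ ≤ ∑ x ∈ X, 3 * #{g | e x g ∈ D} := sum_le_sum hX
    _ ≤ 3 * #D := by rw [← mul_sum]; omega

/-- Removing a set `D` of edges that meets every triangle of the Schur graph of `A` yields a
sum-free subset of `A`. -/
lemma exists_sumFree_of_cliqueFree (A : Finset G) (H : SimpleGraph (G ⊕ G ⊕ G))
    [DecidableRel H.Adj] (hfree : H.CliqueFree 3) :
    ∃ B ⊆ A, IsSumFree (B : Set G) ∧ Fintype.card G * #(A \ B) ≤
      9 * #((graph (schurTriangles A)).edgeFinset \ H.edgeFinset) := by
  set D := (graph (schurTriangles A)).edgeFinset \ H.edgeFinset with hD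
  -- Each `x` labels |G| edges between each pair of vertex classes. An element is discarded if a
  -- third of its edges between some two classes were removed.
  let e₁ : G → G → Sym2 (G ⊕ G ⊕ G) := fun x g ↦ s(in₀ g, in₁ (g + x))
  let e₂ : G → G → Sym2 (G ⊕ G ⊕ G) := fun x g ↦ s(in₁ g, in₂ (g + x))
  let e₃ : G → G → Sym2 (G ⊕ G ⊕ G) := fun x g ↦ s(in₀ g, in₂ (g + x))
  let bad (e : G → G → Sym2 (G ⊕ G ⊕ G)) : Finset G :=
    {x ∈ A | Fintype.card G ≤ 3 * #{g | e x g ∈ D}}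
  have hbad : ∀ e : G → G → Sym2 (G ⊕ G ⊕ G), (Function.Injective fun q : G × G ↦ e q.1 q.2) →
      Fintype.card G * #(bad e) ≤ 3 * #D := fun e he ↦
    card_mul_card_le_of_label D e he _ fun x hx ↦ (mem_filter.1 hx).2
  have h₁ := hbad e₁ (by
    rintro ⟨x, g⟩ ⟨y, k⟩ h
    simp only [e₁, Sym2.eq_iff] at h
    simp at h
    obtain ⟨rfl, h⟩ := h
    simpa using h)
  have h₂ := hbad e₂ (by
    rintro ⟨x, g⟩ ⟨y, k⟩ h
    simp only [e₂, Sym2.eq_iff] at h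
    simp at h
    obtain ⟨rfl, h⟩ := h
    simpa using h)
  have h₃ := hbad e₃ (by
    rintro ⟨x, g⟩ ⟨y, k⟩ h
    simp only [e₃, Sym2.eq_iff] at h
    simp at h
    obtain ⟨rfl, h⟩ := h
    simpa using h)
  refine ⟨A \ (bad e₁ ∪ bad e₂ ∪ bad e₃), sdiff_subset, ?_, ?_⟩
  · intro x hx y hy hxy
    simp only [coe_sdiff, Set.mem_sdiff, mem_coe, mem_union, not_or] at hx hy hxy
    have key : ∀ e, ∀ z, z ∈ A → z ∉ bad e → 3 * #{g | e z g ∈ D} < Fintype.card G := by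
      intro e z hz hzb
      by_contra! h
      exact hzb (mem_filter.2 ⟨hz, h⟩)
    have k1 := key _ _ hx.1 hx.2.1.1
    have k2 := key _ _ hy.1 hy.2.1.2
    have k3 := key _ _ hxy.1 hxy.2.2
    -- Every base point `g` gives a triangle `(g, g + x, g + x + y)` that must lose an edge, but
    -- three sets of fewer than |G|/3 base points cannot cover `G`.
    have hcov : (univ : Finset G) ⊆ ({g | e₁ x g ∈ D} : Finset G) ∪
        ({g | e₂ y g ∈ D} : Finset G).image (fun g ↦ g - x) ∪
        ({g | e₃ (x + y) g ∈ D} : Finset G) := by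
      intro g _
      by_contra hg
      simp only [mem_union, mem_filter, mem_univ, true_and, not_or, mem_image, not_exists,
        not_and] at hg
      have hm : (g, g + x, g + x + y) ∈ schurTriangles A := by
        rw [mem_schurTriangles]
        refine ⟨by simpa using hx.1, by simpa using hy.1, ?_⟩
        rw [add_assoc, add_sub_cancel_left]; exact hxy.1
      have a1 : H.Adj (in₀ g) (in₁ (g + x)) := by
        by_contra h
        exact hg.1.1 (mem_sdiff.2 ⟨by
          simp only [e₁, mem_edgeFinset, mem_edgeSet]
          exact Graph.in₀₁_iff.2 ⟨_, hm⟩, by simpa [e₁] using h⟩)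
      have a2 : H.Adj (in₁ (g + x)) (in₂ (g + x + y)) := by
        by_contra h
        exact hg.1.2 (g + x) (mem_sdiff.2 ⟨by
          simp only [e₂, mem_edgeFinset, mem_edgeSet]
          exact Graph.in₁₂_iff.2 ⟨_, hm⟩, by simpa [e₂] using h⟩) (by simp)
      have a3 : H.Adj (in₀ g) (in₂ (g + x + y)) := by
        by_contra h
        exact hg.2 (mem_sdiff.2 ⟨by
          simp only [e₃, mem_edgeFinset, mem_edgeSet]
          rw [← add_assoc]
          exact Graph.in₀₂_iff.2 ⟨_, hm⟩, by
          simp only [e₃, mem_edgeFinset, mem_edgeSet]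
          rw [← add_assoc]; exact h⟩)
      exact hfree _ (is3Clique_triple_iff.2 ⟨a1, a3, a2⟩)
    have := card_le_card hcov
    have c1 := card_union_le (({g | e₁ x g ∈ D} : Finset G) ∪
        ({g | e₂ y g ∈ D} : Finset G).image (fun g ↦ g - x)) ({g | e₃ (x + y) g ∈ D} : Finset G)
    have c2 := card_union_le ({g | e₁ x g ∈ D} : Finset G)
        (({g | e₂ y g ∈ D} : Finset G).image (fun g ↦ g - x))
    have c3 := card_image_le (s := ({g | e₂ y g ∈ D} : Finset G)) (f := fun g ↦ g - x)
    rw [card_univ] at this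
    omega
  · have hs : A \ (A \ (bad e₁ ∪ bad e₂ ∪ bad e₃)) ⊆ bad e₁ ∪ bad e₂ ∪ bad e₃ := by
      intro x; simp only [mem_sdiff]; tauto
    have := card_le_card hs
    have c1 := card_union_le (bad e₁ ∪ bad e₂) (bad e₃)
    have c2 := card_union_le (bad e₁) (bad e₂)
    calc _ ≤ Fintype.card G * (#(bad e₁) + #(bad e₂) + #(bad e₃)) := by gcongr; omega
      _ ≤ _ := by rw [mul_add, mul_add]; omega

end Removal

/-- The arithmetic removal lemma for Schur triples in finite abelian groups. -/
theorem exists_sumFree_of_card_schurPairs_le {ε : ℝ} (hε : 0 < ε) :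
    ∃ δ : ℝ, 0 < δ ∧ ∀ (G : Type u) [AddCommGroup G] [Fintype G] [DecidableEq G] (A : Finset G),
      (#(schurPairs A) : ℝ) ≤ δ * (Fintype.card G : ℝ) ^ 2 →
      ∃ B ⊆ A, IsSumFree (B : Set G) ∧ (#(A \ B) : ℝ) ≤ ε * Fintype.card G := by
  -- 81 = 9 · 9: the graph has 3|G| vertices, whose square is 9|G|², and passing from edges to
  -- elements costs another 9.
  have hb := triangleRemovalBound_pos (show 0 < ε / 81 by positivity)
  refine ⟨triangleRemovalBound (ε / 81), hb, ?_⟩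
  intro G _ _ _ A hA
  have hn : (0 : ℝ) < Fintype.card G := by exact_mod_cast Fintype.card_pos
  have hcl : (#((graph (schurTriangles A)).cliqueFinset 3) : ℝ) <
      triangleRemovalBound (ε / 81) * (Fintype.card (G ⊕ G ⊕ G) : ℝ) ^ 3 := by
    have h1 := (card_le_card (cliqueFinset_graph_subset A)).trans
      (card_image_le.trans (card_schurTriangles_le A))
    have h2 : (#((graph (schurTriangles A)).cliqueFinset 3) : ℝ) ≤
      Fintype.card G * #(schurPairs A) := by exact_mod_cast h1
    have h3 : (Fintype.card (G ⊕ G ⊕ G) : ℝ) = 3 * Fintype.card G := by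
      simp only [Fintype.card_sum]; push_cast; ring
    rw [h3]
    have h4 : (Fintype.card G : ℝ) * #(schurPairs A) ≤ Fintype.card G *
      (triangleRemovalBound (ε / 81) * (Fintype.card G : ℝ) ^ 2) := by gcongr
    have : 0 < triangleRemovalBound (ε / 81) * (Fintype.card G : ℝ) ^ 3 := by positivity
    nlinarith
  obtain ⟨H, hH, hdec, hcard, hfree⟩ := triangle_removal hcl
  obtain ⟨B, hBA, hB, hle⟩ := exists_sumFree_of_cliqueFree A H hfree
  refine ⟨B, hBA, hB, ?_⟩
  rw [← Nat.cast_sub (card_le_card (edgeFinset_mono hH)),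
    ← card_sdiff_of_subset (edgeFinset_mono hH)] at hcard
  have h3 : ((Fintype.card (G ⊕ G ⊕ G) ^ 2 : ℕ) : ℝ) = 9 * (Fintype.card G : ℝ) ^ 2 := by
    simp only [Fintype.card_sum]; push_cast; ring
  rw [h3] at hcard
  have hle' : (Fintype.card G : ℝ) * #(A \ B) ≤
      9 * #((graph (schurTriangles A)).edgeFinset \ H.edgeFinset) := by exact_mod_cast hle
  refine le_of_mul_le_mul_left (hle'.trans ?_) hn
  nlinarith

end SumFree

/-! ### Containers for sum-free sets. -/

namespace SumFree

open Finset

section Containers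

variable {G : Type u} [AddCommGroup G] [DecidableEq G]

/-- The neighbours of `x` in the Cayley graph of `G` generated by `T`. -/
def cayleyNbr (T : Finset G) (x : G) : Finset G :=
  T.image (fun t ↦ x + t) ∪ T.image (fun t ↦ x - t)

/-- The vertices of `C` that are not adjacent to `P`. -/
def remaining (C T P : Finset G) : Finset G := C \ P.biUnion (cayleyNbr T)

/-- The vertices of `C` that are not adjacent to `P`, and have fewer than `b` neighbours among
the vertices with this property. -/
def cayleyContainer (C T : Finset G) (b : ℕ) (P : Finset G) : Finset G :=
  {v ∈ remaining C T P | #(cayleyNbr T v ∩ remaining C T P) < b}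

/-- Take a largest `P ⊆ S` whose members account for at least `b` neighbours each. Independence
keeps `S` away from the neighbours of `P`, and an element of `S` with `b` fresh neighbours could be
added to `P`. -/
lemma exists_subset_cayleyContainer [Fintype G] {C T S : Finset G} {b : ℕ} (hb : 0 < b)
    (hS : S ⊆ C) (hT : ∀ x ∈ S, ∀ t ∈ T, x + t ∉ S) :
    ∃ P : Finset G, b * #P ≤ Fintype.card G ∧ S ⊆ cayleyContainer C T b P := by
  let Q : Finset (Finset G) := {P ∈ S.powerset | b * #P ≤ #(P.biUnion (cayleyNbr T))}
  have hQ : Q.Nonempty := ⟨∅, by simp [Q]⟩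
  obtain ⟨P, hP, hmax⟩ := exists_max_image Q card hQ
  simp only [Q, mem_filter, mem_powerset] at hP hmax
  refine ⟨P, hP.2.trans (card_le_univ _), fun v hv ↦ ?_⟩
  have hvr : v ∈ remaining C T P := by
    refine mem_sdiff.2 ⟨hS hv, fun h ↦ ?_⟩
    simp only [cayleyNbr, mem_biUnion, mem_union, mem_image] at h
    obtain ⟨p, hp, ⟨t, ht, h⟩ | ⟨t, ht, h⟩⟩ := h
    · exact hT p (hP.1 hp) t ht (h ▸ hv)
    · refine hT v hv t ht ?_
      rw [← h, sub_add_cancel]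
      exact hP.1 hp
  refine mem_filter.2 ⟨hvr, ?_⟩
  by_contra! hge
  have hvP : v ∉ P := by
    intro hvP
    have : cayleyNbr T v ∩ remaining C T P = ∅ := by
      rw [← disjoint_iff_inter_eq_empty]
      refine disjoint_of_subset_left ?_ disjoint_sdiff
      exact subset_biUnion_of_mem (cayleyNbr T) hvP
    rw [this, card_empty] at hge
    omega
  have hins := hmax (insert v P) ⟨insert_subset hv hP.1, ?_⟩
  · rw [card_insert_of_notMem hvP] at hins
    omega
  · rw [card_insert_of_notMem hvP, biUnion_insert, mul_add, mul_one]
    have hd : Disjoint (P.biUnion (cayleyNbr T)) (cayleyNbr T v ∩ remaining C T P) :=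
      disjoint_of_subset_right inter_subset_right disjoint_sdiff
    calc _ ≤ #(P.biUnion (cayleyNbr T)) + #(cayleyNbr T v ∩ remaining C T P) := by
          have := hP.2; omega
      _ = #(P.biUnion (cayleyNbr T) ∪ (cayleyNbr T v ∩ remaining C T P)) :=
          (card_union_of_disjoint hd).symm
      _ ≤ _ := card_le_card (by
          intro x; simp only [mem_union, mem_inter]; tauto)

/-- An edge inside `C` either has an endpoint outside the container, or lies inside it, where
degrees are below `b`. So many edges force the container to be substantially smaller than `C`. -/
lemma sum_card_le_of_cayleyContainer [Fintype G] (C T P : Finset G) (b : ℕ) :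
    ∑ t ∈ T, #{x ∈ C | x + t ∈ C} ≤
      2 * (#T * #(C \ cayleyContainer C T b P)) + b * Fintype.card G := by
  set C' := cayleyContainer C T b P
  have h1 : ∀ t ∈ T, #{x ∈ C | x + t ∈ C} ≤ 2 * #(C \ C') + #{x ∈ C' | x + t ∈ C'} := by
    intro t _
    have hsub : ({x ∈ C | x + t ∈ C} : Finset G) ⊆
        ((C \ C') ∪ (C \ C').image (fun y ↦ y - t)) ∪ {x ∈ C' | x + t ∈ C'} := by
      intro x hx
      simp only [mem_filter, mem_union, mem_sdiff, mem_image] at hx ⊢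
      by_cases h : x ∈ C'
      · by_cases h' : x + t ∈ C'
        · exact .inr ⟨h, h'⟩
        · exact .inl (.inr ⟨x + t, ⟨hx.2, h'⟩, by abel⟩)
      · exact .inl (.inl ⟨hx.1, h⟩)
    have e1 := card_le_card hsub
    have e2 := card_union_le ((C \ C') ∪ (C \ C').image (fun y ↦ y - t)) {x ∈ C' | x + t ∈ C'}
    have e3 := card_union_le (C \ C') ((C \ C').image (fun y ↦ y - t))
    have e4 := card_image_le (s := C \ C') (f := fun y ↦ y - t)
    omega
  have h2 : ∑ t ∈ T, #{x ∈ C' | x + t ∈ C'} ≤ b * Fintype.card G := by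
    calc _ = ∑ x ∈ C', #{t ∈ T | x + t ∈ C'} :=
          sum_card_bipartiteAbove_eq_sum_card_bipartiteBelow (fun t x ↦ x + t ∈ C')
      _ ≤ ∑ x ∈ C', b := by
          refine sum_le_sum fun x hx ↦ ?_
          refine le_trans ?_ (mem_filter.1 hx).2.le
          refine card_le_card_of_injOn (fun t ↦ x + t) ?_ (add_right_injective x).injOn
          intro t ht
          simp only [mem_coe, mem_filter] at ht
          exact mem_inter.2 ⟨mem_union_left _ (mem_image_of_mem _ ht.1), (mem_filter.1 ht.2).1⟩
      _ ≤ _ := by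
          rw [sum_const, smul_eq_mul, mul_comm]
          exact Nat.mul_le_mul_left _ (card_le_univ _)
  calc _ ≤ ∑ t ∈ T, (2 * #(C \ C') + #{x ∈ C' | x + t ∈ C'}) := sum_le_sum h1
    _ ≤ _ := by
      rw [sum_add_distrib, sum_const, smul_eq_mul]
      have : #T * (2 * #(C \ C')) = 2 * (#T * #(C \ C')) := by ring
      omega

lemma cayleyContainer_subset (C T P : Finset G) (b : ℕ) : cayleyContainer C T b P ⊆ C :=
  (filter_subset _ _).trans sdiff_subset

/-- The finsets of size at most `r`. -/
noncomputable def smallSets (α : Type*) [Fintype α] (r : ℝ) : Finset (Finset α) :=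
  {P | (#P : ℝ) ≤ r}

lemma mem_smallSets {α : Type*} [Fintype α] {r : ℝ} {P : Finset α} :
    P ∈ smallSets α r ↔ (#P : ℝ) ≤ r := by simp [smallSets]

lemma card_schurPairs (C : Finset G) : #(schurPairs C) = ∑ v ∈ C, #{x ∈ C | x + v ∈ C} := by
  rw [← card_sigma]
  refine card_bij' (fun p _ ↦ (⟨p.2, p.1⟩ : Σ _ : G, G)) (fun p _ ↦ (p.2, p.1)) ?_ ?_ ?_ ?_ <;>
    simp [schurPairs] <;> tauto

/-- The elements of `C` that are the second term of at least `r` Schur pairs. -/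
noncomputable def popular (C : Finset G) (r : ℝ) : Finset G :=
  {v ∈ C | r ≤ #{x ∈ C | x + v ∈ C}}

lemma le_card_popular [Fintype G] {C : Finset G} {δ : ℝ}
    (hC : δ * (Fintype.card G : ℝ) ^ 2 < #(schurPairs C)) :
    δ / 2 * Fintype.card G ≤ #(popular C (δ / 2 * Fintype.card G)) := by
  have hn : (0 : ℝ) < Fintype.card G := by exact_mod_cast Fintype.card_pos
  set r := δ / 2 * (Fintype.card G : ℝ) with hr
  have hr0 : 0 ≤ r ∨ r < 0 := le_or_gt 0 r
  rcases hr0 with hr0 | hr0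
  swap
  · exact hr0.le.trans (by positivity)
  have h1 : (#(schurPairs C) : ℝ) ≤ #(popular C r) * Fintype.card G + Fintype.card G * r := by
    rw [card_schurPairs, Nat.cast_sum,
      ← sum_filter_add_sum_filter_not C (fun v ↦ r ≤ #{x ∈ C | x + v ∈ C})]
    refine add_le_add ?_ ?_
    · rw [← nsmul_eq_mul]
      refine sum_le_card_nsmul _ _ _ fun v _ ↦ ?_
      exact_mod_cast card_le_univ _
    · refine (sum_le_card_nsmul _ _ r fun v hv ↦ ?_).trans ?_
      · exact (not_le.1 (mem_filter.1 hv).2).le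
      · rw [nsmul_eq_mul]
        gcongr
        exact_mod_cast card_le_univ _
  have h2 : δ * (Fintype.card G : ℝ) ^ 2 = 2 * (r * Fintype.card G) := by rw [hr]; ring
  refine le_of_mul_le_mul_right (?_ : r * Fintype.card G ≤ _) hn
  nlinarith

/-- One step of the container algorithm: if `C` has many Schur pairs, then the sum-free subsets
of `C` are covered by few substantially smaller sets. -/
lemma exists_container_step [Fintype G] {δ η : ℝ} {k q : ℕ} (hδ : 0 < δ) (hk : 0 < k)
    (hkη : 1 ≤ k * η) (hqk : 4 * k ≤ q * δ) (hqη : q ≤ η * Fintype.card G)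
    (hqδ : q ≤ δ / 4 * Fintype.card G) {C : Finset G}
    (hC : δ * (Fintype.card G : ℝ) ^ 2 < #(schurPairs C)) :
    ∃ F : Finset (Finset G), #F ≤ #(smallSets G (η * Fintype.card G)) ^ 2 ∧
      (∀ S : Finset G, S ⊆ C → IsSumFree (S : Set G) → ∃ A ∈ F, S ⊆ A) ∧
      ∀ A ∈ F, (#A : ℝ) + δ / 8 * Fintype.card G ≤ #C := by
  have hn : (0 : ℝ) < Fintype.card G := by exact_mod_cast Fintype.card_pos
  set n : ℝ := (Fintype.card G : ℝ) with hndef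
  set R := popular C (δ / 2 * n) with hR
  -- A pair of small sets encodes a container. If `S` has at least `q` popular elements, `q` of them
  -- generate a Cayley graph in which `S` is independent; otherwise the few popular elements of `S`
  -- are recorded exactly. The size of the first set tells the cases apart.
  let Φ : Finset G × Finset G → Finset G := fun p ↦
    if #p.1 = q then cayleyContainer C p.1 k p.2 else (C \ R) ∪ p.1
  refine ⟨{A ∈ (smallSets G (η * n) ×ˢ smallSets G (η * n)).image Φ |
    (#A : ℝ) + δ / 8 * n ≤ #C}, ?_, ?_, fun A hA ↦ (mem_filter.1 hA).2⟩
  · refine (card_filter_le _ _).trans (card_image_le.trans ?_)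
    rw [card_product, sq]
  intro S hSC hS
  have hmem : ∀ T P : Finset G, (#T : ℝ) ≤ η * n → (#P : ℝ) ≤ η * n → S ⊆ Φ (T, P) →
      (#(Φ (T, P)) : ℝ) + δ / 8 * n ≤ #C → ∃ A ∈ ({A ∈ (smallSets G (η * n) ×ˢ
        smallSets G (η * n)).image Φ | (#A : ℝ) + δ / 8 * n ≤ #C} : Finset (Finset G)), S ⊆ A := by
    intro T P hT hP hsub hcard
    exact ⟨_, mem_filter.2 ⟨mem_image_of_mem _ (mem_product.2
      ⟨mem_smallSets.2 hT, mem_smallSets.2 hP⟩), hcard⟩, hsub⟩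
  have hη : 0 ≤ η * n := by
    by_contra! h
    have : (0 : ℝ) ≤ q := by positivity
    linarith
  by_cases hq : q ≤ #(S ∩ R)
  · obtain ⟨T, hTS, hTq⟩ := exists_subset_card_eq hq
    obtain ⟨P, hPcard, hSP⟩ := exists_subset_cayleyContainer (T := T) hk hSC
      (fun x hx t ht ↦ hS x hx t (mem_inter.1 (hTS ht)).1)
    have hΦ : Φ (T, P) = cayleyContainer C T k P := by simp [Φ, hTq]
    refine hmem T P (by rw [hTq]; exact hqη) ?_ (by rw [hΦ]; exact hSP) ?_
    · have h1 : (k : ℝ) * #P ≤ n := by rw [hndef]; exact_mod_cast hPcard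
      have hk' : (0 : ℝ) < k := by exact_mod_cast hk
      refine le_of_mul_le_mul_left (h1.trans ?_) hk'
      nlinarith
    · rw [hΦ]
      have h1 := sum_card_le_of_cayleyContainer C T P k
      have h2 : (q : ℝ) * (δ / 2 * n) ≤ ((∑ t ∈ T, #{x ∈ C | x + t ∈ C} : ℕ) : ℝ) := by
        rw [Nat.cast_sum, ← hTq, ← nsmul_eq_mul]
        refine card_nsmul_le_sum _ _ _ fun t ht ↦ ?_
        exact (mem_filter.1 (mem_inter.1 (hTS ht)).2).2
      have h3 : ((∑ t ∈ T, #{x ∈ C | x + t ∈ C} : ℕ) : ℝ) ≤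
          2 * (q * #(C \ cayleyContainer C T k P)) + k * n := by
        rw [← hTq, hndef]; exact_mod_cast h1
      have hq0 : (0 : ℝ) < q := by
        by_contra! h
        have : (0 : ℝ) < k := by exact_mod_cast hk
        nlinarith
      have h4 : δ / 8 * n ≤ #(C \ cayleyContainer C T k P) := by
        refine le_of_mul_le_mul_left ?_ hq0
        nlinarith
      have h5 := card_sdiff_add_card_eq_card (cayleyContainer_subset C T P k)
      have h6 : (#(C \ cayleyContainer C T k P) : ℝ) + #(cayleyContainer C T k P) = #C := by
        exact_mod_cast h5
      linarith
  · push Not at hq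
    have hΦ : Φ (S ∩ R, ∅) = (C \ R) ∪ (S ∩ R) := by simp [Φ, hq.ne]
    have hq' : (#(S ∩ R) : ℝ) < q := by exact_mod_cast hq
    refine hmem (S ∩ R) ∅ (hq'.le.trans hqη) (by simpa using hη) ?_ ?_
    · rw [hΦ]
      intro x hx
      have := hSC hx
      simp only [mem_union, mem_sdiff, mem_inter]
      tauto
    · rw [hΦ]
      have h1 : δ / 2 * n ≤ #R := le_card_popular hC
      have h2 := card_sdiff_add_card_eq_card (filter_subset _ _ : R ⊆ C)
      have h3 : (#(C \ R) : ℝ) + #R = #C := by exact_mod_cast h2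
      have h4 : (#((C \ R) ∪ (S ∩ R)) : ℝ) ≤ #(C \ R) + #(S ∩ R) := by
        exact_mod_cast card_union_le _ _
      nlinarith

/-- Each step removes at least δ|G|/8 elements, so `m` bounds the number of rounds, and each round
multiplies the family by at most the square of the number of small sets. -/
lemma exists_containers_aux [Fintype G] {δ η : ℝ} {k q : ℕ} (hδ : 0 < δ) (hk : 0 < k)
    (hkη : 1 ≤ k * η) (hqk : 4 * k ≤ q * δ) (hqη : q ≤ η * Fintype.card G)
    (hqδ : q ≤ δ / 4 * Fintype.card G) (m : ℕ) :
    ∀ C : Finset G, (#C : ℝ) ≤ m * (δ / 8 * Fintype.card G) →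
    ∃ F : Finset (Finset G), #F ≤ (#(smallSets G (η * Fintype.card G)) ^ 2) ^ m ∧
      (∀ S : Finset G, S ⊆ C → IsSumFree (S : Set G) → ∃ A ∈ F, S ⊆ A) ∧
      ∀ A ∈ F, (#(schurPairs A) : ℝ) ≤ δ * (Fintype.card G : ℝ) ^ 2 := by
  have hM : 0 < #(smallSets G (η * Fintype.card G)) := by
    refine card_pos.2 ⟨∅, mem_smallSets.2 ?_⟩
    have : (0 : ℝ) ≤ q := by positivity
    simpa using this.trans hqη
  have hfew : ∀ m, ∀ C : Finset G, (#(schurPairs C) : ℝ) ≤ δ * (Fintype.card G : ℝ) ^ 2 →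
      ∃ F : Finset (Finset G), #F ≤ (#(smallSets G (η * Fintype.card G)) ^ 2) ^ m ∧
      (∀ S : Finset G, S ⊆ C → IsSumFree (S : Set G) → ∃ A ∈ F, S ⊆ A) ∧
      ∀ A ∈ F, (#(schurPairs A) : ℝ) ≤ δ * (Fintype.card G : ℝ) ^ 2 := by
    intro m C hC
    refine ⟨{C}, ?_, fun S hS _ ↦ ⟨C, mem_singleton_self _, hS⟩, by simpa using hC⟩
    rw [card_singleton]
    exact Nat.one_le_iff_ne_zero.2 (by positivity)
  induction m with
  | zero =>
    intro C hC
    refine hfew 0 C ?_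
    have : #C = 0 := by
      have : (#C : ℝ) ≤ 0 := by simpa using hC
      exact_mod_cast le_antisymm this (by positivity)
    rw [card_eq_zero] at this
    subst this
    simp only [schurPairs, empty_product, filter_empty, card_empty, Nat.cast_zero]
    positivity
  | succ m ih =>
    intro C hC
    by_cases hfewC : (#(schurPairs C) : ℝ) ≤ δ * (Fintype.card G : ℝ) ^ 2
    · exact hfew _ C hfewC
    push Not at hfewC
    obtain ⟨F, hFc, hF, hFs⟩ := exists_container_step hδ hk hkη hqk hqη hqδ hfewC
    have hex : ∀ A ∈ F, _ := fun A hA ↦ ih A (by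
      have := hFs A hA
      push_cast at hC
      linarith)
    choose! E hE using hex
    refine ⟨F.biUnion E, ?_, ?_, ?_⟩
    · refine card_biUnion_le.trans ?_
      refine (sum_le_card_nsmul _ _ _ fun A hA ↦ (hE A hA).1).trans ?_
      rw [smul_eq_mul, pow_succ _ m, mul_comm]
      exact Nat.mul_le_mul_left _ hFc
    · intro S hSC hS
      obtain ⟨A, hA, hSA⟩ := hF S hSC hS
      obtain ⟨B, hB, hSB⟩ := (hE A hA).2.1 S hSA hS
      exact ⟨B, mem_biUnion.2 ⟨A, hA, hB⟩, hSB⟩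
    · intro B hB
      obtain ⟨A, hA, hB⟩ := mem_biUnion.1 hB
      exact (hE A hA).2.2 B hB

end Containers

/-- For small `η` there are subexponentially many subsets of relative size `η`. -/
lemma exists_card_smallSets_le {γ : ℝ} (hγ : 0 < γ) :
    ∃ η : ℝ, 0 < η ∧ ∀ (α : Type u) [Fintype α],
      (#(smallSets α (η * Fintype.card α)) : ℝ) ≤ Real.exp (γ * Fintype.card α) := by
  set c := γ / 2 with hc
  have hc0 : 0 < c := by positivity
  set L := |Real.log c| + 1 with hL
  have hL0 : 0 < L := by positivity
  set x := min c 1 with hx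
  have hx0 : 0 < x := lt_min hc0 one_pos
  have hx1 : x ≤ 1 := min_le_right _ _
  have hlog : -L ≤ Real.log x := by
    rcases le_total c 1 with h | h
    · rw [hx, min_eq_left h]
      have := neg_abs_le (Real.log c)
      linarith
    · rw [hx, min_eq_right h, Real.log_one]
      linarith
  refine ⟨c / L, by positivity, fun α _ ↦ ?_⟩
  classical
  set n : ℝ := (Fintype.card α : ℝ) with hn
  have h1 : ∑ P : Finset α, x ^ #P = (x + 1) ^ Fintype.card α := by
    have := sum_pow_mul_eq_add_pow x 1 (univ : Finset α)
    simpa using this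
  -- Weight each set by x^|P|: a small set has weight at least exp(-cn), while all weights sum to (1
  -- + x)^n ≤ exp(cn).
  have h2 : (#(smallSets α (c / L * n)) : ℝ) * Real.exp (-(c * n)) ≤
      ∑ P : Finset α, x ^ #P := by
    rw [← nsmul_eq_mul]
    refine (card_nsmul_le_sum _ (fun P ↦ x ^ #P) _ fun P hP ↦ ?_).trans
      (sum_le_sum_of_subset_of_nonneg (subset_univ _) fun _ _ _ ↦ by positivity)
    rw [mem_smallSets] at hP
    rw [← Real.log_le_log_iff (Real.exp_pos _) (by positivity), Real.log_exp, Real.log_pow]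
    have h3 : (#P : ℝ) * L ≤ c * n := by
      calc (#P : ℝ) * L ≤ c / L * n * L := by gcongr
        _ = c * n := by field_simp
    have h4 : (#P : ℝ) * -L ≤ #P * Real.log x := by gcongr
    linarith
  have h3 : (x + 1) ^ Fintype.card α ≤ Real.exp (c * n) := by
    calc (x + 1) ^ Fintype.card α ≤ (Real.exp c) ^ Fintype.card α := by
          gcongr
          exact (Real.add_one_le_exp x).trans (Real.exp_le_exp.2 (min_le_left _ _))
      _ = _ := by rw [← Real.exp_nat_mul, mul_comm]
  have h5 := h2.trans (h1.le.trans h3)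
  rw [Real.exp_neg, ← div_eq_mul_inv, div_le_iff₀ (Real.exp_pos _), ← Real.exp_add] at h5
  rwa [← add_mul, hc, add_halves] at h5

/-- The container theorem for sum-free sets in finite abelian groups. -/
theorem exists_containers {δ γ : ℝ} (hδ : 0 < δ) (hγ : 0 < γ) :
    ∃ N : ℕ, ∀ (G : Type u) [AddCommGroup G] [Fintype G] [DecidableEq G], N ≤ Fintype.card G →
      ∃ F : Finset (Finset G), (#F : ℝ) ≤ Real.exp (γ * Fintype.card G) ∧
      (∀ S : Finset G, IsSumFree (S : Set G) → ∃ A ∈ F, S ⊆ A) ∧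
      ∀ A ∈ F, (#(schurPairs A) : ℝ) ≤ δ * (Fintype.card G : ℝ) ^ 2 := by
  obtain ⟨m, hm⟩ := exists_nat_gt (8 / δ)
  have hm0 : (0 : ℝ) < m := lt_trans (by positivity) hm
  obtain ⟨η, hη, hsmall⟩ := exists_card_smallSets_le.{u} (show 0 < γ / (2 * m) by positivity)
  obtain ⟨k, hk⟩ := exists_nat_gt (1 / η)
  have hk0 : (0 : ℝ) < k := lt_trans (by positivity) hk
  obtain ⟨q, hq⟩ := exists_nat_gt (4 * k / δ)
  obtain ⟨N, hN⟩ := exists_nat_gt (max (q / η) (q / (δ / 4)))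
  refine ⟨N, fun G _ _ _ hG ↦ ?_⟩
  have hG' : (N : ℝ) ≤ Fintype.card G := by exact_mod_cast hG
  obtain ⟨h1, h2⟩ := max_lt_iff.1 (hN.trans_le hG')
  rw [div_lt_iff₀' (by positivity)] at h1 h2 hq hk hm
  obtain ⟨F, hFc, hF, hFs⟩ := exists_containers_aux (G := G) hδ (k := k) (q := q) (η := η)
    (by exact_mod_cast hk0) (by linarith) (by linarith) h1.le h2.le m univ (by
      rw [card_univ]
      have : (0 : ℝ) ≤ Fintype.card G := by positivity
      nlinarith)
  refine ⟨F, ?_, fun S hS ↦ hF S (subset_univ _) hS, hFs⟩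
  calc (#F : ℝ) ≤ ((#(smallSets G (η * Fintype.card G)) : ℝ) ^ 2) ^ m := by exact_mod_cast hFc
    _ ≤ ((Real.exp (γ / (2 * m) * Fintype.card G)) ^ 2) ^ m := by
      gcongr
      exact hsmall G
    _ = Real.exp (γ * Fintype.card G) := by
      rw [← pow_mul, ← Real.exp_nat_mul]
      congr 1
      push_cast
      field_simp

end SumFree

/-! ### The Moon–Moser bound. -/

namespace SumFree

open Finset

section MoonMoser

variable {α : Type u} [DecidableEq α]

open Classical in
/-- The maximal independent sets of the subgraph of `Γ` induced on `V`. -/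
noncomputable def maxIndepSets (Γ : SimpleGraph α) (V : Finset α) : Finset (Finset α) :=
  {X ∈ V.powerset | (∀ x ∈ X, ∀ y ∈ X, ¬ Γ.Adj x y) ∧ ∀ v ∈ V, v ∉ X → ∃ x ∈ X, Γ.Adj v x}

open Classical in
/-- The closed neighbourhood of `v` in `V`. -/
noncomputable def closedNbr (Γ : SimpleGraph α) (V : Finset α) (v : α) : Finset α :=
  {u ∈ V | u = v ∨ Γ.Adj v u}

lemma mem_maxIndepSets {Γ : SimpleGraph α} {V X : Finset α} : X ∈ maxIndepSets Γ V ↔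
    X ⊆ V ∧ (∀ x ∈ X, ∀ y ∈ X, ¬ Γ.Adj x y) ∧ ∀ v ∈ V, v ∉ X → ∃ x ∈ X, Γ.Adj v x := by
  simp [maxIndepSets]

lemma mem_closedNbr {Γ : SimpleGraph α} {V : Finset α} {u v : α} :
    u ∈ closedNbr Γ V v ↔ u ∈ V ∧ (u = v ∨ Γ.Adj v u) := by
  simp [closedNbr]

/-- Maximality makes `X` meet the closed neighbourhood of `v`, say in `u`. What remains is maximal
away from the closed neighbourhood of `u`, since `u` dominates nothing there. -/
lemma maxIndepSets_subset_biUnion {Γ : SimpleGraph α} {V : Finset α} {v : α} (hv : v ∈ V) :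
    maxIndepSets Γ V ⊆ (closedNbr Γ V v).biUnion fun u ↦
      (maxIndepSets Γ (V \ closedNbr Γ V u)).image (insert u) := by
  intro X hX
  rw [mem_maxIndepSets] at hX
  obtain ⟨hXV, hind, hmax⟩ := hX
  obtain ⟨u, huX, hu⟩ : ∃ u ∈ X, u = v ∨ Γ.Adj v u := by
    by_cases h : v ∈ X
    · exact ⟨v, h, .inl rfl⟩
    · obtain ⟨u, hu, hvu⟩ := hmax v hv h
      exact ⟨u, hu, .inr hvu⟩
  refine mem_biUnion.2 ⟨u, mem_closedNbr.2 ⟨hXV huX, hu⟩, mem_image.2 ⟨X.erase u, ?_,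
    insert_erase huX⟩⟩
  rw [mem_maxIndepSets]
  refine ⟨fun x hx ↦ ?_, fun x hx y hy ↦ hind x (mem_of_mem_erase hx) y (mem_of_mem_erase hy),
    fun w hw hwX ↦ ?_⟩
  · rw [mem_erase] at hx
    refine mem_sdiff.2 ⟨hXV hx.2, fun h ↦ ?_⟩
    rcases (mem_closedNbr.1 h).2 with h | h
    · exact hx.1 h
    · exact hind u huX x hx.2 h
  · rw [mem_sdiff, mem_closedNbr] at hw
    have hwu : w ≠ u := fun h ↦ hw.2 ⟨hw.1, .inl h⟩
    have hnadj : ¬ Γ.Adj u w := fun h ↦ hw.2 ⟨hw.1, .inr h⟩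
    obtain ⟨x, hx, hwx⟩ := hmax w hw.1 fun h ↦ hwX (mem_erase.2 ⟨hwu, h⟩)
    refine ⟨x, mem_erase.2 ⟨?_, hx⟩, hwx⟩
    rintro rfl
    exact hnadj hwx.symm

/-- Equality at `s = 3` corresponds to disjoint triangles and is the source of the base 3. -/
lemma natCast_le_three_rpow (s : ℕ) : (s : ℝ) ≤ (3 : ℝ) ^ ((s : ℝ) / 3) := by
  have key : ∀ s : ℕ, s ^ 3 ≤ 3 ^ s := by
    intro s
    rcases lt_or_ge s 3 with h | h
    · interval_cases s <;> norm_num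
    · induction s, h using Nat.le_induction with
      | base => norm_num
      | succ k hk ih =>
        rw [pow_succ 3 k]
        nlinarith [Nat.mul_le_mul hk (Nat.mul_le_mul hk le_rfl : 3 * k ≤ k * k),
          Nat.mul_le_mul hk (le_refl k)]
  have h1 : ((s : ℝ)) ^ 3 ≤ 3 ^ s := by exact_mod_cast key s
  have h2 : ((3 : ℝ) ^ ((s : ℝ) / 3)) ^ 3 = 3 ^ s := by
    rw [← Real.rpow_natCast, ← Real.rpow_mul (by norm_num)]
    norm_num
  exact le_of_pow_le_pow_left₀ (by norm_num) (by positivity) (h1.trans h2.ge)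

/-- The Moon–Moser bound: a graph on `n` vertices has at most `3 ^ (n / 3)` maximal independent
sets. -/
theorem card_maxIndepSets_le (Γ : SimpleGraph α) (V : Finset α) :
    (#(maxIndepSets Γ V) : ℝ) ≤ (3 : ℝ) ^ ((#V : ℝ) / 3) := by
  induction V using Finset.strongInduction with
  | H V ih =>
    rcases V.eq_empty_or_nonempty with rfl | hV
    · have : maxIndepSets Γ (∅ : Finset α) ⊆ {∅} := by
        intro X hX
        simpa using (mem_maxIndepSets.1 hX).1
      simpa using card_le_card this
    -- With the smallest closed neighbourhood, of size `s`, there are `s` branches and each deletes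
    -- at least `s` vertices.
    obtain ⟨v, hv, hmin⟩ := exists_min_image V (fun v ↦ #(closedNbr Γ V v)) hV
    set s := #(closedNbr Γ V v) with hs
    have hbound : ∀ u ∈ closedNbr Γ V v,
        (#((maxIndepSets Γ (V \ closedNbr Γ V u)).image (insert u)) : ℝ) ≤
          (3 : ℝ) ^ (((#V : ℝ) - s) / 3) := by
      intro u hu
      have huV := (mem_closedNbr.1 hu).1
      have hsub : closedNbr Γ V u ⊆ V := fun x hx ↦ (mem_closedNbr.1 hx).1
      have hss : V \ closedNbr Γ V u ⊂ V :=
        sdiff_ssubset hsub ⟨u, mem_closedNbr.2 ⟨huV, .inl rfl⟩⟩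
      have h1 : (#((maxIndepSets Γ (V \ closedNbr Γ V u)).image (insert u)) : ℝ) ≤
        #(maxIndepSets Γ (V \ closedNbr Γ V u)) := by exact_mod_cast card_image_le
      refine h1.trans ((ih _ hss).trans ?_)
      have h2 : (#(V \ closedNbr Γ V u) : ℝ) + #(closedNbr Γ V u) = #V := by
        exact_mod_cast card_sdiff_add_card_eq_card hsub
      have h3 : (s : ℝ) ≤ #(closedNbr Γ V u) := by exact_mod_cast hmin u huV
      exact Real.rpow_le_rpow_of_exponent_le (by norm_num) (by linarith)
    calc (#(maxIndepSets Γ V) : ℝ)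
        ≤ ∑ u ∈ closedNbr Γ V v,
          (#((maxIndepSets Γ (V \ closedNbr Γ V u)).image (insert u)) : ℝ) := by
          exact_mod_cast (card_le_card (maxIndepSets_subset_biUnion hv)).trans card_biUnion_le
      _ ≤ s * (3 : ℝ) ^ (((#V : ℝ) - s) / 3) := by
          rw [← nsmul_eq_mul]
          exact sum_le_card_nsmul _ _ _ hbound
      _ ≤ (3 : ℝ) ^ ((s : ℝ) / 3) * (3 : ℝ) ^ (((#V : ℝ) - s) / 3) := by
          gcongr
          exact natCast_le_three_rpow s
      _ = _ := by
          rw [← Real.rpow_add (by norm_num)]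
          congr 1
          ring

end MoonMoser

end SumFree

/-! ### Link graphs and the upper bound. -/

namespace SumFree

open Finset

section

variable {G : Type u} [AddCommGroup G]

lemma isSumFree_mono {S T : Set G} (h : S ⊆ T) (hT : IsSumFree T) : IsSumFree S :=
  fun x hx y hy hxy ↦ hT x (h hx) y (h hy) (h hxy)

/-- The link graph of `S`: `b` and `c` are joined if they form a Schur triple with `S`. -/
def linkGraph (S : Set G) : SimpleGraph G where
  Adj b c := b ≠ c ∧ ¬ IsSumFree (insert b (insert c S))
  symm := ⟨fun b c h ↦ ⟨h.1.symm, by rw [Set.insert_comm]; exact h.2⟩⟩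
  loopless := ⟨fun b h ↦ h.1 rfl⟩

/-- A Schur triple not contained in `X` has at most two elements in `X`, so conditions on pairs
suffice. -/
lemma isSumFree_union {X S : Set G} (hX : IsSumFree X) (hS : IsSumFree S)
    (h : ∀ b ∈ X, ∀ c ∈ X, IsSumFree (insert b (insert c S))) : IsSumFree (X ∪ S) := by
  rintro x (hx | hx) y (hy | hy) (hz | hz)
  · exact hX x hx y hy hz
  · exact h x hx y hy x (by simp) y (by simp) (by simp [hz])
  · exact h x hx _ hz x (by simp) y (by simp [hy]) (by simp)
  · exact h x hx x hx x (by simp) y (by simp [hy]) (by simp [hz])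
  · exact h y hy _ hz x (by simp [hx]) y (by simp) (by simp)
  · exact h y hy y hy x (by simp [hx]) y (by simp) (by simp [hz])
  · exact h _ hz _ hz x (by simp [hx]) y (by simp [hy]) (by simp)
  · exact hS x hx y hy hz

open Classical in
/-- The elements of `B` that are compatible with `S`. -/
noncomputable def linkVerts (S B : Finset G) : Finset G :=
  {b ∈ B | IsSumFree (insert b (S : Set G))}

lemma mem_linkVerts {S B : Finset G} {b : G} :
    b ∈ linkVerts S B ↔ b ∈ B ∧ IsSumFree (insert b (S : Set G)) := by simp [linkVerts]

variable [DecidableEq G]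

/-- A maximal sum-free set traces a maximal independent set of a link graph on a sum-free set. -/
lemma inter_mem_maxIndepSets {M B : Finset G} (hM : Maximal IsSumFree (M : Set G))
    (hB : IsSumFree (B : Set G)) :
    M ∩ B ∈ maxIndepSets (linkGraph ((M \ B : Finset G) : Set G)) (linkVerts (M \ B) B) := by
  have hsub : ((M \ B : Finset G) : Set G) ⊆ M := coe_subset.2 sdiff_subset
  rw [mem_maxIndepSets]
  refine ⟨fun x hx ↦ ?_, fun x hx y hy h ↦ ?_, fun v hv hvM ↦ ?_⟩
  · rw [mem_inter] at hx
    exact mem_linkVerts.2 ⟨hx.2, isSumFree_mono (Set.insert_subset (mem_coe.2 hx.1) hsub) hM.prop⟩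
  · rw [mem_inter] at hx hy
    exact h.2 (isSumFree_mono (Set.insert_subset (mem_coe.2 hx.1)
      (Set.insert_subset (mem_coe.2 hy.1) hsub)) hM.prop)
  · by_contra! hno
    rw [mem_linkVerts] at hv
    have hcomp : ∀ x ∈ M ∩ B, IsSumFree (insert v (insert x ((M \ B : Finset G) : Set G))) := by
      intro x hx
      by_contra h
      exact hno x hx ⟨fun e ↦ hvM (e ▸ hx), h⟩
    -- A compatible `v` with no neighbour in `M ∩ B` could be added to `M`, against maximality.
    have hfree : IsSumFree (insert v ((M ∩ B : Finset G) : Set G) ∪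
        ((M \ B : Finset G) : Set G)) := by
      refine isSumFree_union (isSumFree_mono ?_ hB) (isSumFree_mono hsub hM.prop) ?_
      · exact Set.insert_subset (mem_coe.2 hv.1) (coe_subset.2 inter_subset_right)
      · rintro b (rfl | hb) c (rfl | hc)
        · rw [Set.insert_idem]; exact hv.2
        · exact hcomp c hc
        · rw [Set.insert_comm]; exact hcomp b hb
        · exact isSumFree_mono (Set.insert_subset (mem_coe.2 (mem_inter.1 hb).1)
            (Set.insert_subset (mem_coe.2 (mem_inter.1 hc).1) hsub)) hM.prop
    have hle : (M : Set G) ⊆ insert v ((M ∩ B : Finset G) : Set G) ∪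
        ((M \ B : Finset G) : Set G) := by
      intro x hx
      by_cases hxB : x ∈ B
      · exact .inl (.inr (mem_coe.2 (mem_inter.2 ⟨hx, hxB⟩)))
      · exact .inr (mem_coe.2 (mem_sdiff.2 ⟨hx, hxB⟩))
    have hvM' : v ∈ (M : Set G) := hM.le_of_ge hfree hle (.inl (.inl rfl))
    exact hvM (mem_inter.2 ⟨hvM', hv.1⟩)

open Classical in
/-- The number of maximal sum-free subsets of a set `A` that is nearly sum-free. -/
lemma card_maximal_le [Fintype G] {A B : Finset G} (hB : IsSumFree (B : Set G)) :
    (#({M | Maximal IsSumFree (M : Set G) ∧ M ⊆ A} : Finset (Finset G)) : ℝ) ≤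
      2 ^ #(A \ B) * (3 : ℝ) ^ ((#B : ℝ) / 3) := by
  have hsub : ({M | Maximal IsSumFree (M : Set G) ∧ M ⊆ A} : Finset (Finset G)) ⊆
      (A \ B).powerset.biUnion fun S ↦
        (maxIndepSets (linkGraph (S : Set G)) (linkVerts S B)).image (S ∪ ·) := by
    intro M hM
    simp only [mem_filter, mem_univ, true_and] at hM
    refine mem_biUnion.2 ⟨M \ B, mem_powerset.2 (sdiff_subset_sdiff hM.2 Subset.rfl),
      mem_image.2 ⟨M ∩ B, inter_mem_maxIndepSets hM.1 hB, sdiff_union_inter M B⟩⟩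
  calc (#({M | Maximal IsSumFree (M : Set G) ∧ M ⊆ A} : Finset (Finset G)) : ℝ)
      ≤ ∑ S ∈ (A \ B).powerset,
        (#((maxIndepSets (linkGraph (S : Set G)) (linkVerts S B)).image (S ∪ ·)) : ℝ) := by
        exact_mod_cast (card_le_card hsub).trans card_biUnion_le
    _ ≤ #((A \ B).powerset) • (3 : ℝ) ^ ((#B : ℝ) / 3) := by
        refine sum_le_card_nsmul _ _ _ fun S _ ↦ ?_
        refine (Nat.cast_le.2 card_image_le).trans ((card_maxIndepSets_le _ _).trans ?_)
        refine Real.rpow_le_rpow_of_exponent_le (by norm_num) ?_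
        gcongr
        exact fun x hx ↦ (mem_linkVerts.1 hx).1
    _ = _ := by rw [card_powerset, nsmul_eq_mul]; push_cast; rfl

end

lemma card_le_muSumFree {G : Type u} [AddCommGroup G] [Finite G] {B : Finset G}
    (hB : IsSumFree (B : Set G)) : #B ≤ muSumFree G := by
  refine le_csSup ⟨Nat.card G, ?_⟩ ⟨B, hB, Set.ncard_coe_finset B⟩
  rintro k ⟨S, -, rfl⟩
  exact Set.ncard_le_card S

open Classical in
lemma fMax_eq_card (G : Type u) [AddCommGroup G] [Fintype G] :
    fMax G = #({M | Maximal IsSumFree (M : Set G)} : Finset (Finset G)) := by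
  rw [fMax, ← Set.ncard_coe_finset, ← Set.ncard_image_of_injective _ (coe_injective (α := G))]
  congr 1
  ext S
  simp only [Set.mem_ofPred_eq, coe_filter, mem_univ, true_and, Set.mem_image]
  constructor
  · intro h
    exact ⟨S.toFinite.toFinset, by simpa using h, by simp⟩
  · rintro ⟨M, hM, rfl⟩
    exact hM

/-- Every finite abelian group `G` has at most `3 ^ (μ(G) / 3 + o(|G|))` maximal sum-free sets. -/
theorem exists_fMax_le {ε : ℝ} (hε : 0 < ε) :
    ∃ N : ℕ, ∀ (G : Type u) [AddCommGroup G] [Finite G], N ≤ Nat.card G →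
      (fMax G : ℝ) ≤ Real.exp (ε * Nat.card G) * (3 : ℝ) ^ ((muSumFree G : ℝ) / 3) := by
  classical
  obtain ⟨δ, hδ, hrem⟩ := exists_sumFree_of_card_schurPairs_le.{u} (half_pos hε)
  obtain ⟨N, hN⟩ := exists_containers.{u} hδ (half_pos hε)
  refine ⟨N, fun G _ _ hG ↦ ?_⟩
  have := Fintype.ofFinite G
  rw [Nat.card_eq_fintype_card] at hG ⊢
  obtain ⟨F, hFc, hF, hFs⟩ := hN G hG
  have hbound : ∀ A ∈ F,
      (#({M | Maximal IsSumFree (M : Set G) ∧ M ⊆ A} : Finset (Finset G)) : ℝ) ≤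
        Real.exp (ε / 2 * Fintype.card G) * (3 : ℝ) ^ ((muSumFree G : ℝ) / 3) := by
    intro A hA
    obtain ⟨B, -, hB, hAB⟩ := hrem G A (hFs A hA)
    refine (card_maximal_le hB).trans ?_
    gcongr
    · calc (2 : ℝ) ^ #(A \ B) ≤ (Real.exp 1) ^ #(A \ B) := by
            gcongr
            linarith [Real.add_one_le_exp 1]
        _ = Real.exp (#(A \ B)) := by rw [← Real.exp_nat_mul, mul_one]
        _ ≤ _ := Real.exp_le_exp.2 hAB
    · norm_num
    · exact card_le_muSumFree hB
  have hcov : ({M | Maximal IsSumFree (M : Set G)} : Finset (Finset G)) ⊆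
      F.biUnion fun A ↦ {M | Maximal IsSumFree (M : Set G) ∧ M ⊆ A} := by
    intro M hM
    rw [mem_filter] at hM
    obtain ⟨A, hA, hMA⟩ := hF M hM.2.prop
    exact mem_biUnion.2 ⟨A, hA, mem_filter.2 ⟨mem_univ _, hM.2, hMA⟩⟩
  rw [fMax_eq_card]
  calc (#({M | Maximal IsSumFree (M : Set G)} : Finset (Finset G)) : ℝ)
      ≤ ∑ A ∈ F, (#({M | Maximal IsSumFree (M : Set G) ∧ M ⊆ A} : Finset (Finset G)) : ℝ) := by
        exact_mod_cast (card_le_card hcov).trans card_biUnion_le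
    _ ≤ #F • (Real.exp (ε / 2 * Fintype.card G) * (3 : ℝ) ^ ((muSumFree G : ℝ) / 3)) :=
        sum_le_card_nsmul _ _ _ hbound
    _ ≤ Real.exp (ε / 2 * Fintype.card G) *
        (Real.exp (ε / 2 * Fintype.card G) * (3 : ℝ) ^ ((muSumFree G : ℝ) / 3)) := by
        rw [nsmul_eq_mul]
        gcongr
    _ = _ := by
        rw [← mul_assoc, ← Real.exp_add, ← add_mul, add_halves]

end SumFree

/-! ### A Mann-type theorem by the isoperimetric method. -/

namespace SumFree

open Finset
open scoped Pointwise

section Mann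

variable {G : Type u} [AddCommGroup G] [Fintype G] [DecidableEq G]

lemma compl_add_neg_subset (X S : Finset G) : (X + S)ᶜ + -S ⊆ Xᶜ := by
  intro z hz
  obtain ⟨y, hy, t, ht, rfl⟩ := mem_add.1 hz
  rw [mem_compl] at hy ⊢
  intro h
  refine hy ?_
  have := add_mem_add h (mem_neg'.1 ht)
  rwa [add_neg_cancel_right] at this

/-- If `X` minimizes `(|X + S| - |X|, |X|)` lexicographically among nonempty sets with
`X + S ≠ G`, and `|X| + |X + S| ≤ |G|`, then translates of `X` are equal or disjoint. -/
lemma vadd_eq_of_inter_nonempty {S X : Finset G} (hX : X.Nonempty) (hXS : X + S ≠ univ)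
    (hcard : #X + #(X + S) ≤ Fintype.card G)
    (hmin : ∀ Y : Finset G, Y.Nonempty → Y + S ≠ univ → #(X + S) + #Y ≤ #(Y + S) + #X)
    (hatom : ∀ Y : Finset G, Y.Nonempty → Y + S ≠ univ → #(X + S) + #Y = #(Y + S) + #X →
      #X ≤ #Y) {g : G} (hg : ((g +ᵥ X) ∩ X).Nonempty) : g +ᵥ X = X := by
  by_contra hne
  have hcg : #(g +ᵥ X) = #X := card_vadd_finset g X
  have hI : #((g +ᵥ X) ∩ X) < #X := by
    refine card_lt_card ⟨inter_subset_right, fun h ↦ hne ?_⟩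
    exact (eq_of_subset_of_card_le (fun x hx ↦ (mem_inter.1 (h hx)).1) hcg.le).symm
  have hgS : #((g +ᵥ X) + S) = #(X + S) := by rw [vadd_add_assoc, card_vadd_finset]
  have hIS : ((g +ᵥ X) ∩ X) + S ≠ univ := fun h ↦
    hXS (univ_subset_iff.1 (h ▸ add_subset_add_right inter_subset_right))
  have h1 := hmin _ hg hIS
  have h2 := hatom _ hg hIS
  -- Submodularity: intersection and union must then both attain the minimal excess, so the
  -- intersection is a smaller minimizer. The hypothesis `hcard` keeps the union admissible.
  have h3 : #(((g +ᵥ X) ∩ X) + S) + #(((g +ᵥ X) ∪ X) + S) ≤ #(X + S) + #(X + S) := by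
    rw [union_add]
    have e1 := card_union_add_card_inter ((g +ᵥ X) + S) (X + S)
    have e2 := card_le_card (inter_add_subset (s₁ := g +ᵥ X) (s₂ := X) (t := S))
    omega
  have h4 := card_union_add_card_inter (g +ᵥ X) X
  have h5 := hg.card_pos
  have hUS : ((g +ᵥ X) ∪ X) + S ≠ univ := by
    intro h
    rw [h, card_univ] at h3
    omega
  have h6 := hmin _ (hX.mono subset_union_right) hUS
  omega

omit [Fintype G] in
/-- A finite set all of whose translates are equal to it or disjoint from it is a coset. -/
lemma exists_addSubgroup_of_vadd {X : Finset G} (hX : X.Nonempty)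
    (h : ∀ g : G, ((g +ᵥ X) ∩ X).Nonempty → g +ᵥ X = X) :
    ∃ (H : AddSubgroup G) (x : G), ∀ y, y ∈ X ↔ y - x ∈ H := by
  obtain ⟨x, hx⟩ := hX
  refine ⟨AddAction.stabilizer G X, x, fun y ↦ ?_⟩
  rw [AddAction.mem_stabilizer_iff]
  constructor
  · intro hy
    refine h _ ⟨y, mem_inter.2 ⟨?_, hy⟩⟩
    exact mem_vadd_finset.2 ⟨x, hx, by simp⟩
  · intro hy
    rw [← hy]
    exact mem_vadd_finset.2 ⟨x, hx, by simp⟩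

/-- The elements of a subgroup, as a finset. -/
noncomputable def subgroupFinset (H : AddSubgroup G) : Finset G := (H : Set G).toFinite.toFinset

/-- A form of **Mann's theorem**: if `|X + S| < |X| + |S| - 1` and `X + S ≠ G` for some nonempty
`X`, then this happens for some subgroup `X`. -/
theorem exists_addSubgroup_card_add_lt {S X : Finset G} (hX : X.Nonempty)
    (hXS : X + S ≠ univ) (hlt : #(X + S) + 1 < #X + #S) :
    ∃ H : AddSubgroup G, subgroupFinset H + S ≠ univ ∧
      #(subgroupFinset H + S) + 1 < #(subgroupFinset H) + #S := by
  -- Both `S` and `-S` compete, so that passing from `A` to the complement of `A + T` with `-T`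
  -- stays in the family.
  let P : Finset (Finset G × Finset G) := {p ∈ ({S, -S} : Finset (Finset G)) ×ˢ univ |
    p.2.Nonempty ∧ p.2 + p.1 ≠ univ}
  obtain ⟨⟨T, A⟩, hA, hmin⟩ := exists_min_image P
    (fun p ↦ toLex ((#(p.2 + p.1) : ℤ) - #p.2, #p.2)) ⟨(S, X), by simp [P, hX, hXS]⟩
  have hTS : T = S ∨ T = -S := by
    have := (mem_product.1 (mem_filter.1 hA).1).1
    simpa using this
  have hTS' : -T = S ∨ -T = -S := by
    rcases hTS with rfl | rfl <;> simp
  obtain ⟨hA0, hAT⟩ : A.Nonempty ∧ A + T ≠ univ := (mem_filter.1 hA).2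
  have hmin' : ∀ U Y : Finset G, (U = S ∨ U = -S) → Y.Nonempty → Y + U ≠ univ →
      #(A + T) + #Y ≤ #(Y + U) + #A ∧ (#(A + T) + #Y = #(Y + U) + #A → #A ≤ #Y) := by
    intro U Y hU hY hYU
    have := hmin (U, Y) (by simp [P, hU, hY, hYU])
    rw [Prod.Lex.toLex_le_toLex] at this
    dsimp only at this
    omega
  have hXS' := (hmin' S X (.inl rfl) hX hXS).1
  -- The dual set has excess at most that of `A`, hence equal, so the minimal size of `A` gives |A|
  -- ≤ |G| - |A + T|.
  have hdual : #A + #(A + T) ≤ Fintype.card G := by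
    have hne : ((A + T)ᶜ).Nonempty := by
      rw [nonempty_iff_ne_empty, Ne, compl_eq_empty_iff]
      exact hAT
    have hsub := compl_add_neg_subset A T
    have hne' : (A + T)ᶜ + -T ≠ univ := by
      intro h
      obtain ⟨a, ha⟩ := hA0
      have := hsub (h ▸ mem_univ a)
      exact (mem_compl.1 this) ha
    have h1 := hmin' (-T) (A + T)ᶜ hTS' hne hne'
    have h2 := card_le_card hsub
    rw [card_compl] at h2
    have h3 := card_compl (A + T)
    have h4 := card_le_univ (A + T)
    have h5 := card_le_univ A
    omega
  have hT : T = S ∨ T = -S := hTS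
  obtain ⟨H, x, hH⟩ := exists_addSubgroup_of_vadd hA0 fun g hg ↦
    vadd_eq_of_inter_nonempty hA0 hAT hdual (fun Y hY hYT ↦ (hmin' T Y hT hY hYT).1)
      (fun Y hY hYT ↦ (hmin' T Y hT hY hYT).2) hg
  have hAH : A = x +ᵥ subgroupFinset H := by
    ext y
    rw [hH, mem_vadd_finset]
    constructor
    · intro h
      exact ⟨y - x, by simpa [subgroupFinset] using h, by simp⟩
    · rintro ⟨z, hz, rfl⟩
      simpa [subgroupFinset] using hz
  have hcA : #A = #(subgroupFinset H) := by rw [hAH, card_vadd_finset]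
  have hcAT : #(A + T) = #(subgroupFinset H + T) := by
    rw [hAH, vadd_add_assoc, card_vadd_finset]
  have hcT : #(subgroupFinset H + T) = #(subgroupFinset H + S) := by
    rcases hTS with rfl | rfl
    · rfl
    · rw [← card_neg (subgroupFinset H + -S), neg_add, neg_neg]
      congr 2
      ext y
      simp [subgroupFinset]
  refine ⟨H, fun h ↦ hAT ?_, by omega⟩
  rw [← card_eq_iff_eq_univ] at h ⊢
  omega

end Mann

/-! ### Sum-free sets and cosets; the bound |S| ≤ |G|/3. -/

section

variable {G : Type u} [AddCommGroup G] [Fintype G]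

open Classical in
/-- The number of elements of `S` in a coset of `H`. -/
noncomputable def cosetCount (H : AddSubgroup G) (S : Finset G) (a : G ⧸ H) : ℕ :=
  #(S.filter fun s : G ↦ (s : G ⧸ H) = a)

lemma card_le_card_subgroupFinset {H : AddSubgroup G} {U : Finset G} {a : G ⧸ H}
    (hU : ∀ u ∈ U, (u : G ⧸ H) = a) : #U ≤ #(subgroupFinset H) := by
  rcases U.eq_empty_or_nonempty with rfl | ⟨u, hu⟩
  · simp
  refine card_le_card_of_injOn (fun x ↦ -u + x) ?_ (add_right_injective (-u)).injOn
  intro x hx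
  have : (u : G ⧸ H) = x := (hU u hu).trans (hU x hx).symm
  simpa [subgroupFinset] using QuotientAddGroup.eq.1 this

omit [Fintype G] in
open Classical in
lemma card_eq_sum_cosetCount (H : AddSubgroup G) (S : Finset G) :
    #S = ∑ a ∈ S.image ((↑) : G → G ⧸ H), cosetCount H S a := by
  rw [card_eq_sum_card_image ((↑) : G → G ⧸ H) S]
  refine sum_congr rfl fun a _ ↦ ?_
  unfold cosetCount
  congr

open Classical in
lemma cosetCount_le (H : AddSubgroup G) (S : Finset G) (a : G ⧸ H) :
    cosetCount H S a ≤ #(subgroupFinset H) := by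
  unfold cosetCount
  exact card_le_card_subgroupFinset (a := a) fun u hu ↦ (mem_filter.1 hu).2

variable [DecidableEq G]

open Classical in
lemma card_mul_card_image_le (H : AddSubgroup G) (S : Finset G) :
    #(subgroupFinset H) * #(S.image ((↑) : G → G ⧸ H)) ≤ #(subgroupFinset H + S) := by
  have hmaps : ∀ x ∈ subgroupFinset H + S, (x : G ⧸ H) ∈ S.image ((↑) : G → G ⧸ H) := by
    intro x hx
    obtain ⟨h, hh, s, hs, rfl⟩ := mem_add.1 hx
    refine mem_image.2 ⟨s, hs, ?_⟩
    rw [QuotientAddGroup.eq]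
    simpa [subgroupFinset] using hh
  rw [card_eq_sum_card_fiberwise hmaps, mul_comm, ← smul_eq_mul]
  refine card_nsmul_le_sum _ _ _ fun a ha ↦ ?_
  obtain ⟨s, hs, rfl⟩ := mem_image.1 ha
  refine card_le_card_of_injOn (fun h ↦ h + s) ?_ (add_left_injective s).injOn
  intro h hh
  simp only [mem_coe, mem_filter]
  refine ⟨add_mem_add hh hs, ?_⟩
  rw [eq_comm, QuotientAddGroup.eq]
  simpa [subgroupFinset] using hh

/-- Translating the part of `S` in the coset `a` by an element of `S` in `b` lands in `a + b`,
disjointly from `S`. -/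
lemma cosetCount_add_le {H : AddSubgroup G} {S : Finset G} (hS : IsSumFree (S : Set G))
    {a b : G ⧸ H} (hb : ∃ s ∈ S, (s : G ⧸ H) = b) :
    cosetCount H S a + cosetCount H S (a + b) ≤ #(subgroupFinset H) := by
  classical
  obtain ⟨s, hs, rfl⟩ := hb
  have hd : Disjoint (({x ∈ S | (x : G ⧸ H) = a} : Finset G).image (fun x ↦ x + s))
      {x ∈ S | (x : G ⧸ H) = a + s} := by
    rw [disjoint_left]
    intro y hy hy'
    obtain ⟨x, hx, rfl⟩ := mem_image.1 hy
    exact hS x (mem_filter.1 hx).1 s hs (mem_filter.1 hy').1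
  have hc := card_union_of_disjoint hd
  rw [card_image_of_injective _ (add_left_injective s)] at hc
  have hle := card_le_card_subgroupFinset (H := H) (a := a + s)
    (U := ({x ∈ S | (x : G ⧸ H) = a} : Finset G).image (fun x ↦ x + s) ∪
      {x ∈ S | (x : G ⧸ H) = a + s}) ?_
  · rw [hc] at hle
    unfold cosetCount
    convert hle
  intro y hy
  rcases mem_union.1 hy with h | h
  · obtain ⟨x, hx, rfl⟩ := mem_image.1 h
    rw [QuotientAddGroup.mk_add, (mem_filter.1 hx).2]
  · exact (mem_filter.1 h).2

open Classical in
/-- If `S` fills almost all of `H + S`, then two cosets contain more than `|H|` elements. -/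
lemma lt_cosetCount_add {H : AddSubgroup G} {S : Finset G}
    (hlt : #(subgroupFinset H + S) + 1 < #(subgroupFinset H) + #S) {a b : G ⧸ H}
    (ha : a ∈ S.image ((↑) : G → G ⧸ H)) (hb : b ∈ S.image ((↑) : G → G ⧸ H)) (hab : a ≠ b) :
    #(subgroupFinset H) < cosetCount H S a + cosetCount H S b := by
  have h1 := card_mul_card_image_le H S
  have h2 := card_eq_sum_cosetCount H S
  have h3 : ∑ c ∈ (S.image ((↑) : G → G ⧸ H)).erase a |>.erase b, cosetCount H S c ≤
      #((S.image ((↑) : G → G ⧸ H)).erase a |>.erase b) • #(subgroupFinset H) :=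
    sum_le_card_nsmul _ _ _ fun c _ ↦ cosetCount_le H S c
  have hb' : b ∈ (S.image ((↑) : G → G ⧸ H)).erase a := mem_erase.2 ⟨hab.symm, hb⟩
  have h4 := add_sum_erase _ (cosetCount H S) ha
  have h5 := add_sum_erase _ (cosetCount H S) hb'
  have h6 := card_erase_add_one ha
  have h7 := card_erase_add_one hb'
  rw [smul_eq_mul] at h3
  set h := #(subgroupFinset H)
  set k := #((S.image ((↑) : G → G ⧸ H)).erase a |>.erase b)
  have h8 : #(S.image ((↑) : G → G ⧸ H)) = k + 2 := by omega
  rw [h8, mul_add] at h1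
  rw [mul_comm] at h3
  omega

open Classical in
/-- If a sum-free set `S` fills almost all of `H + S`, then either it is contained in `H`, or its
image modulo `H` is sum-free. -/
lemma subset_or_isSumFree_image {H : AddSubgroup G} {S : Finset G} (hS : IsSumFree (S : Set G))
    (hlt : #(subgroupFinset H + S) + 1 < #(subgroupFinset H) + #S) :
    (∀ s ∈ S, s ∈ H) ∨ IsSumFree (S.image ((↑) : G → G ⧸ H) : Set (G ⧸ H)) := by
  by_contra! hcon
  obtain ⟨⟨s, hs, hsH⟩, hnot⟩ := hcon
  simp only [IsSumFree, not_forall, not_not, exists_prop] at hnot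
  obtain ⟨a, ha, b, hb, hab⟩ := hnot
  rw [mem_coe] at ha hb hab
  have h1 := cosetCount_add_le hS (a := a) (mem_image.1 hb)
  have h2 := cosetCount_add_le hS (a := b) (mem_image.1 ha)
  have e1 : a = a + b := by
    by_contra hne
    exact absurd h1 (lt_cosetCount_add hlt ha hab hne).not_ge
  have e2 : b = b + a := by
    by_contra hne
    rw [add_comm] at hab
    exact absurd h2 (lt_cosetCount_add hlt hb hab hne).not_ge
  -- Only 0 + 0 = 0 is left. Then `S` fills at most half of `H` and also at most half of the coset
  -- of `s`, but the two together exceed |H|.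
  obtain rfl : b = 0 := by simpa using e1.symm
  obtain rfl : a = 0 := by simpa using e2.symm
  have hs0 : (s : G ⧸ H) ≠ 0 := by rwa [Ne, QuotientAddGroup.eq_zero_iff]
  have hsI : (s : G ⧸ H) ∈ S.image ((↑) : G → G ⧸ H) := mem_image_of_mem _ hs
  have h3 := cosetCount_add_le hS (a := (s : G ⧸ H)) (mem_image.1 hb)
  have h4 := lt_cosetCount_add hlt ha hsI hs0.symm
  rw [add_zero] at h1 h3
  omega

end

lemma mod_three_ne_two {n : ℕ} (h : ∀ p : ℕ, p.Prime → p ∣ n → p % 3 ≠ 2) : n % 3 ≠ 2 := by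
  induction n using induction_on_primes with
  | zero => simp
  | one => simp
  | prime_mul p a hp ih =>
    have h1 := h p hp (dvd_mul_right _ _)
    have h2 := ih fun q hq hqa ↦ h q hq (hqa.mul_left _)
    rw [Nat.mul_mod]
    have h3 : p % 3 < 3 := Nat.mod_lt _ (by norm_num)
    have h4 : a % 3 < 3 := Nat.mod_lt _ (by norm_num)
    interval_cases p % 3 <;> interval_cases a % 3 <;> simp_all

/-- If no prime congruent to `2` modulo `3` divides `|G|`, then sum-free subsets of `G` contain
at most a third of its elements. -/
theorem three_mul_card_le_of_isSumFree (n : ℕ) : ∀ (G : Type u) [AddCommGroup G] [Finite G],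
    Nat.card G = n → (∀ p : ℕ, p.Prime → p ∣ n → p % 3 ≠ 2) →
    ∀ S : Finset G, IsSumFree (S : Set G) → 3 * #S ≤ n := by
  classical
  induction n using Nat.strong_induction_on with
  | _ n ih =>
  intro G _ _ hn hp S hS
  have := Fintype.ofFinite G
  rw [Nat.card_eq_fintype_card] at hn
  by_contra! hcard
  have hS0 : S.Nonempty := by
    rw [← card_pos]; omega
  have hdisj : Disjoint (S + S) S := by
    rw [disjoint_left]
    intro z hz hzS
    obtain ⟨x, hx, y, hy, rfl⟩ := mem_add.1 hz
    exact hS x hx y hy hzS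
  have h1 := card_union_of_disjoint hdisj
  have h2 := card_le_univ (S + S ∪ S)
  -- Since |G| is not 2 mod 3, 3|S| > |G| improves to 3|S| ≥ |G| + 2, exactly what |S + S| ≤ |G| -
  -- |S| needs to give |S + S| + 1 < 2|S|.
  have hmod := mod_three_ne_two hp
  have hSS : S + S ≠ univ := by
    intro h
    have h3 : #(S + S) = Fintype.card G := by rw [h, card_univ]
    have := hS0.card_pos
    omega
  obtain ⟨H, hH, hlt⟩ := exists_addSubgroup_card_add_lt (S := S) hS0 hSS (by omega)
  have hHcard : Nat.card H = #(subgroupFinset H) := by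
    rw [subgroupFinset, ← Set.ncard_eq_toFinset_card, ← Nat.card_coe_set_eq]
    rfl
  have hmul := AddSubgroup.card_eq_card_quotient_mul_card_addSubgroup H
  rw [Nat.card_eq_fintype_card (α := G), hn, hHcard] at hmul
  have hn0 : 0 < n := hn ▸ Fintype.card_pos
  rcases subset_or_isSumFree_image hS hlt with hsub | hfree
  · have hlt' : #(subgroupFinset H) < n := by
      rw [← hn, ← card_univ]
      refine card_lt_card ((ssubset_univ_iff).2 fun h ↦ hH ?_)
      rw [h]
      obtain ⟨s, hs⟩ := hS0
      exact eq_univ_of_forall fun x ↦ mem_add.2 ⟨x - s, mem_univ _, s, hs, sub_add_cancel x s⟩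
    have := ih _ hlt' H hHcard (fun p hpp hpd ↦ hp p hpp (hpd.trans (Dvd.intro_left _ hmul.symm)))
      (S.preimage Subtype.val Subtype.val_injective.injOn) (by
        intro x hx y hy hxy
        simp only [coe_preimage, Set.mem_preimage, mem_coe] at hx hy hxy
        exact hS _ hx _ hy (by simpa using hxy))
    rw [← card_image_of_injective _ Subtype.val_injective, image_preimage,
      filter_true_of_mem (by simpa using hsub)] at this
    omega
  · have h3 := card_mul_card_image_le H S
    have h4 : 1 < #(subgroupFinset H) := by
      have : #S ≤ #(subgroupFinset H + S) := by
        refine card_le_card fun x hx ↦ mem_add.2 ⟨0, ?_, x, hx, zero_add x⟩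
        simp [subgroupFinset]
      omega
    have hq0 : 0 < Nat.card (G ⧸ H) := Nat.card_pos
    have hlt' : Nat.card (G ⧸ H) < n := by rw [hmul]; nlinarith
    have h5 := ih _ hlt' (G ⧸ H) rfl
      (fun p hpp hpd ↦ hp p hpp (hpd.trans (Dvd.intro _ hmul.symm))) _ hfree
    have h6 : #S ≤ #(S.image ((↑) : G → G ⧸ H)) * #(subgroupFinset H) := by
      rw [card_eq_sum_cosetCount H S, ← smul_eq_mul]
      exact sum_le_card_nsmul _ _ _ fun a _ ↦ cosetCount_le H S a
    rw [hmul] at hcard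
    nlinarith

lemma three_mul_muSumFree_le {G : Type u} [AddCommGroup G] [Finite G] (hG : IsTypeII G) :
    3 * muSumFree G ≤ Nat.card G := by
  have h : muSumFree G ≤ Nat.card G / 3 := by
    refine csSup_le ⟨0, ∅, by simp [IsSumFree], by simp⟩ ?_
    rintro k ⟨S, hS, rfl⟩
    have := three_mul_card_le_of_isSumFree _ G rfl hG.2 S.toFinite.toFinset (by simpa using hS)
    rw [← Set.ncard_eq_toFinset_card] at this
    omega
  omega

end SumFree

/-! ### The lower bound from transversals. -/

namespace SumFree

open Finset

/-- Multiplication by 3 kills an element of order 3, so it is not surjective. Thus G/3G is a nonzero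
space over the field with three elements and has a nonzero functional. -/
lemma exists_surjective_zmod_three (G : Type u) [AddCommGroup G] [Finite G]
    (h3 : 3 ∣ Nat.card G) : ∃ φ : G →+ ZMod 3, Function.Surjective φ := by
  obtain ⟨s, hs⟩ := exists_prime_addOrderOf_dvd_card' 3 h3
  set K : AddSubgroup G := (nsmulAddMonoidHom (α := G) 3).range with hK
  have hKtop : K ≠ ⊤ := by
    intro h
    have hsurj : Function.Surjective (nsmulAddMonoidHom (α := G) 3) :=
      AddMonoidHom.range_eq_top.1 h
    have hinj := Finite.injective_iff_surjective.2 hsurj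
    have : s = 0 := hinj (by
      simp only [nsmulAddMonoidHom_apply, smul_zero]
      rw [← hs]; exact addOrderOf_nsmul_eq_zero s)
    rw [this, addOrderOf_zero] at hs
    omega
  obtain ⟨g, hg⟩ : ∃ g : G, g ∉ K := by
    by_contra! h
    exact hKtop (eq_top_iff.2 fun x _ ↦ h x)
  let _ : Module (ZMod 3) (G ⧸ K) := AddCommGroup.zmodModule (by
    intro x
    obtain ⟨y, rfl⟩ := QuotientAddGroup.mk_surjective x
    rw [← QuotientAddGroup.mk_nsmul, QuotientAddGroup.eq_zero_iff]
    exact ⟨y, rfl⟩)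
  have hg0 : (g : G ⧸ K) ≠ 0 := by rwa [Ne, QuotientAddGroup.eq_zero_iff]
  obtain ⟨f, hf⟩ : ∃ f : Module.Dual (ZMod 3) (G ⧸ K), f (g : G ⧸ K) ≠ 0 := by
    by_contra! h
    exact hg0 ((Module.forall_dual_apply_eq_zero_iff (ZMod 3) _).1 h)
  have hfs : Function.Surjective f := LinearMap.surjective (fun h ↦ hf (by rw [h]; rfl))
  exact ⟨f.toAddMonoidHom.comp (QuotientAddGroup.mk' K),
    hfs.comp (QuotientAddGroup.mk'_surjective K)⟩

section

variable {G : Type u} [AddCommGroup G]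

lemma card_ker_eq (φ : G →+ ZMod 3) (hφ : Function.Surjective φ) :
    3 * Nat.card φ.ker = Nat.card G := by
  rw [← AddSubgroup.card_mul_index φ.ker, AddSubgroup.index_ker,
    AddMonoidHom.range_eq_top.2 hφ, AddSubgroup.card_top, Nat.card_zmod, mul_comm]

variable [Fintype G]

/-- The fibre over `1` of a homomorphism to `ZMod 3`. -/
def fiberOne (φ : G →+ ZMod 3) : Finset G := {x | φ x = 1}

lemma mem_fiberOne {φ : G →+ ZMod 3} {x : G} : x ∈ fiberOne φ ↔ φ x = 1 := by simp [fiberOne]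

lemma isSumFree_fiberOne (φ : G →+ ZMod 3) : IsSumFree (fiberOne φ : Set G) := by
  intro x hx y hy hxy
  rw [mem_coe, mem_fiberOne] at hx hy hxy
  rw [map_add, hx, hy] at hxy
  exact absurd hxy (by decide)

lemma three_mul_card_fiberOne (φ : G →+ ZMod 3) (hφ : Function.Surjective φ) :
    3 * #(fiberOne φ) = Nat.card G := by
  rw [← card_ker_eq φ hφ]
  obtain ⟨b, hb⟩ := hφ 1
  congr 1
  rw [← Nat.card_eq_finsetCard]
  refine Nat.card_congr ⟨fun x ↦ ⟨x.1 - b, ?_⟩, fun x ↦ ⟨x.1 + b, ?_⟩, fun x ↦ ?_, fun x ↦ ?_⟩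
  · rw [AddMonoidHom.mem_ker, map_sub, mem_fiberOne.1 x.2, hb, sub_self]
  · rw [mem_fiberOne, map_add, x.2, hb, zero_add]
  · simp
  · simp

/-- The set `{s}` together with a transversal of the cosets of `⟨s⟩` in `B`, given by the choice
`t` of a point in each coset relative to a base point `r`. -/
def transversalSet {ι : Type*} (s : G) (r : ι → G) (t : ι → Fin 3) :
    Set G :=
  insert s (Set.range fun q ↦ r q + (t q : ℕ) • s)

/-- A finite abelian group `G` whose order is divisible by `9` has at least `3 ^ (|G| / 9)`
maximal sum-free sets. -/
theorem three_pow_le_fMax (h9 : 9 ∣ Nat.card G) : 3 ^ (Nat.card G / 9) ≤ fMax G := by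
  classical
  obtain ⟨φ, hφ⟩ := exists_surjective_zmod_three G ((by norm_num : 3 ∣ 9).trans h9)
  have hker := card_ker_eq φ hφ
  have hfib := three_mul_card_fiberOne φ hφ
  obtain ⟨s, hs⟩ := exists_prime_addOrderOf_dvd_card' (G := φ.ker) 3 (by omega)
  have hs3 : 3 • (s : G) = 0 := by
    have := addOrderOf_nsmul_eq_zero s
    rw [hs] at this
    exact_mod_cast congrArg Subtype.val this
  have hs0 : (s : G) ≠ 0 := by
    intro h
    have : s = 0 := Subtype.ext h
    rw [this, addOrderOf_zero] at hs
    omega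
  have hφs : φ (s : G) = 0 := s.2
  obtain ⟨s, hsker⟩ := s
  dsimp only at hs3 hs0 hφs
  set L := AddSubgroup.zmultiples s with hL
  have hLcard : Nat.card L = 3 := by
    rw [hL, Nat.card_zmultiples]
    exact addOrderOf_eq_prime hs3 hs0
  set Q : Finset (G ⧸ L) := (fiberOne φ).image ((↑) : G → G ⧸ L) with hQ
  have hQcard : Nat.card G / 9 ≤ #Q := by
    have : #(fiberOne φ) ≤ 3 * #Q := by
      refine card_le_mul_card_image _ _ fun a _ ↦ ?_
      refine (card_le_card_subgroupFinset (H := L) (a := a) fun u hu ↦ (mem_filter.1 hu).2).trans ?_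
      rw [subgroupFinset, ← Set.ncard_eq_toFinset_card, ← Nat.card_coe_set_eq]
      exact hLcard.le
    omega
  have hrep : ∀ q : Q, ∃ x : G, φ x = 1 ∧ (x : G ⧸ L) = q := by
    intro q
    obtain ⟨x, hx, hxq⟩ := mem_image.1 q.2
    exact ⟨x, mem_fiberOne.1 hx, hxq⟩
  choose r hr1 hrq using hrep
  have hφt : ∀ (t : Q → Fin 3) q, φ (r q + (t q : ℕ) • s) = 1 := by
    intro t q
    rw [map_add, map_nsmul, hr1, hφs, smul_zero, add_zero]
  have hqt : ∀ (t : Q → Fin 3) q, ((r q + (t q : ℕ) • s : G) : G ⧸ L) = q := by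
    intro t q
    rw [← hrq q, eq_comm, QuotientAddGroup.eq, neg_add_cancel_left]
    exact AddSubgroup.nsmul_mem _ (AddSubgroup.mem_zmultiples s) _
  -- Under `φ`, `s` has value 0 and the other points have value 1. Apart from s + s = s, only s + b
  -- = b' is compatible; it puts b and b' in one coset, so b = b' and s = 0.
  have hfree : ∀ t : Q → Fin 3, IsSumFree (transversalSet s r t) := by
    intro t
    rintro x (rfl | ⟨q, rfl⟩) y (rfl | ⟨q', rfl⟩) (hz | ⟨q'', hz⟩)
    · exact hs0 (by simpa using hz)
    · have := congrArg φ hz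
      rw [hφt, map_add, hφs] at this
      exact absurd this (by decide)
    · have := congrArg φ hz
      rw [map_add, hφt, hφs] at this
      exact absurd this (by decide)
    · have h1 := congrArg ((↑) : G → G ⧸ L) hz
      simp only [] at h1
      rw [hqt, QuotientAddGroup.mk_add, hqt, (QuotientAddGroup.eq_zero_iff _).2
        (AddSubgroup.mem_zmultiples _), zero_add] at h1
      have h2 : q'' = q' := Subtype.ext h1
      subst h2
      exact hs0 (by simpa using hz)
    · have := congrArg φ hz
      rw [map_add, hφt, hφs] at this
      exact absurd this (by decide)
    · have h1 := congrArg ((↑) : G → G ⧸ L) hz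
      simp only [] at h1
      rw [hqt, QuotientAddGroup.mk_add, hqt, (QuotientAddGroup.eq_zero_iff _).2
        (AddSubgroup.mem_zmultiples _), add_zero] at h1
      have h2 : q'' = q := Subtype.ext h1
      subst h2
      exact hs0 (by simpa using hz)
    · have := congrArg φ hz
      rw [map_add, hφt, hφt, hφs] at this
      exact absurd this (by decide)
    · have := congrArg φ hz
      simp only [] at this
      rw [hφt, map_add, hφt, hφt] at this
      exact absurd this (by decide)
  have hext : ∀ t : Q → Fin 3, ∃ M, transversalSet s r t ≤ M ∧ Maximal IsSumFree M := fun t ↦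
    Finite.exists_le_maximal (hfree t)
  choose M hM hMmax using hext
  have hinj : Function.Injective M := by
    intro t t' htt
    by_contra hne
    obtain ⟨q, hq⟩ := Function.ne_iff.1 hne
    have hsM : s ∈ M t := hM t (.inl rfl)
    have h1 : r q + (t q : ℕ) • s ∈ M t := hM t (.inr ⟨q, rfl⟩)
    have h2 : r q + (t' q : ℕ) • s ∈ M t := htt ▸ hM t' (.inr ⟨q, rfl⟩)
    -- Distinct points of a coset of ⟨s⟩ differ by ±s, so a sum-free set containing `s` holds at
    -- most one of them.
    have hstep : ∀ i j : Fin 3, i ≠ j → (i : ℕ) • s + s = (j : ℕ) • s ∨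
        (j : ℕ) • s + s = (i : ℕ) • s := by
      have e3 : s + s + s = 0 := by rw [← hs3]; abel
      intro i j hij
      fin_cases i <;> fin_cases j <;> simp [two_nsmul, e3] at hij ⊢
    rcases hstep _ _ hq with h | h
    · exact (hMmax t).prop _ h1 s hsM (by rw [add_assoc, h]; exact h2)
    · exact (hMmax t).prop _ h2 s hsM (by rw [add_assoc, h]; exact h1)
  calc 3 ^ (Nat.card G / 9) ≤ 3 ^ #Q := Nat.pow_le_pow_right (by norm_num) hQcard
    _ = Nat.card (Q → Fin 3) := by simp
    _ = (Set.range M).ncard := by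
      rw [← Nat.card_coe_set_eq, Nat.card_range_of_injective hinj]
    _ ≤ fMax G := by
      refine Set.ncard_le_ncard ?_ (Set.toFinite _)
      rintro _ ⟨t, rfl⟩
      exact hMmax t

end

lemma three_mul_muSumFree_eq {G : Type u} [AddCommGroup G] [Finite G] (hG : IsTypeII G) :
    3 * muSumFree G = Nat.card G := by
  classical
  have := Fintype.ofFinite G
  obtain ⟨φ, hφ⟩ := exists_surjective_zmod_three G hG.1
  have h1 := three_mul_card_fiberOne φ hφ
  have h2 := card_le_muSumFree (isSumFree_fiberOne φ)
  have h3 := three_mul_muSumFree_le hG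
  omega

lemma three_rpow_le_fMax {G : Type u} [AddCommGroup G] [Finite G] (hG : IsTypeII G)
    (h9 : 9 ∣ Nat.card G) : (3 : ℝ) ^ ((muSumFree G : ℝ) / 3) ≤ fMax G := by
  classical
  have := Fintype.ofFinite G
  have h1 := three_pow_le_fMax h9
  have h2 := three_mul_muSumFree_eq hG
  have h3 : (muSumFree G : ℝ) / 3 = (Nat.card G / 9 : ℕ) := by
    have : muSumFree G = 3 * (Nat.card G / 9) := by omega
    rw [this]; push_cast; ring
  rw [h3, Real.rpow_natCast]
  exact_mod_cast h1

lemma isTypeII_of_card_eq {G : Type u} {k : ℕ} (hk : k ≠ 0) (hG : Nat.card G = 3 ^ k) :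
    IsTypeII G := by
  refine ⟨hG ▸ dvd_pow_self 3 hk, fun p hp hpd ↦ ?_⟩
  rw [hG] at hpd
  rw [(Nat.prime_dvd_prime_iff_eq hp Nat.prime_three).1 (hp.dvd_of_dvd_pow hpd)]
  norm_num

end SumFree

/-! ### The asymptotic formula and the counterexample. -/

open SumFree

/-- First part: for finite abelian groups `G` of type II whose order is divisible by `9`,
`f_max(G) = 3 ^ ((1/3 + o(1)) μ(G))` as `|G| → ∞`, uniformly in `G`. Second part: the bound
`f_max(G) ≤ 2 ^ ((1/2 + o(1)) μ(G))` does not hold for all finite abelian groups `G`. -/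
theorem proposition1p5 :
    (∀ ε : ℝ, 0 < ε → ∃ N : ℕ, ∀ (G : Type u) [AddCommGroup G] [Finite G],
      N ≤ Nat.card G → IsTypeII G → 9 ∣ Nat.card G →
        ∃ δ : ℝ, |δ| ≤ ε ∧
          (fMax G : ℝ) = (3 : ℝ) ^ ((1 / 3 + δ) * (muSumFree G : ℝ))) ∧
    ¬ (∀ ε : ℝ, 0 < ε → ∃ N : ℕ, ∀ (G : Type u) [AddCommGroup G] [Finite G],
      N ≤ Nat.card G →
        (fMax G : ℝ) ≤ (2 : ℝ) ^ ((1 / 2 + ε) * (muSumFree G : ℝ))) := by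
  constructor
  · intro ε hε
    -- As |G| = 3μ, the error factor becomes exp(εμ), which is at most 3^(εμ).
    obtain ⟨N, hN⟩ := exists_fMax_le.{u} (show 0 < ε / 3 by positivity)
    refine ⟨N, fun G _ _ hG hII h9 ↦ ?_⟩
    have hup := hN G hG
    have hlow := three_rpow_le_fMax hII h9
    have hmu := three_mul_muSumFree_eq hII
    have hcard : 0 < Nat.card G := Nat.card_pos
    have hmu0 : (0 : ℝ) < muSumFree G := by
      have : 0 < muSumFree G := by omega
      exact_mod_cast this
    have hcard' : (Nat.card G : ℝ) = 3 * muSumFree G := by exact_mod_cast hmu.symm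
    have hf0 : (0 : ℝ) < fMax G := lt_of_lt_of_le (by positivity) hlow
    have hlog3 : 1 ≤ Real.log 3 := by
      rw [Real.le_log_iff_exp_le (by norm_num)]
      exact Real.exp_one_lt_d9.le.trans (by norm_num)
    have hl := Real.log_le_log (by positivity) hlow
    have hu := Real.log_le_log hf0 hup
    rw [Real.log_mul (by positivity) (by positivity), Real.log_exp,
      Real.log_rpow (by norm_num), hcard'] at hu
    rw [Real.log_rpow (by norm_num)] at hl
    have hpos : 0 < Real.log 3 * muSumFree G := by positivity
    have hδ : (1 / 3 + (Real.log (fMax G) / (Real.log 3 * muSumFree G) - 1 / 3)) *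
        (muSumFree G : ℝ) = Real.log (fMax G) / Real.log 3 := by
      field_simp
      ring
    refine ⟨Real.log (fMax G) / (Real.log 3 * muSumFree G) - 1 / 3, ?_, ?_⟩
    · rw [abs_le]
      constructor
      · have : 1 / 3 ≤ Real.log (fMax G) / (Real.log 3 * muSumFree G) := by
          rw [le_div_iff₀ hpos]
          linarith
        linarith
      · rw [sub_le_iff_le_add, div_le_iff₀ hpos]
        have : ε * muSumFree G ≤ ε * (Real.log 3 * muSumFree G) := by
          gcongr
          nlinarith
        linarith
    · rw [hδ, Real.rpow_def_of_pos (by norm_num), mul_div_cancel₀ _ (by positivity),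
        Real.exp_log hf0]
  · intro h
    obtain ⟨N, hN⟩ := h (1 / 100) (by norm_num)
    have hcard : Nat.card (ULift.{u} (ZMod (3 ^ (N + 2)))) = 3 ^ (N + 2) := by simp
    have : NeZero (3 ^ (N + 2)) := ⟨by positivity⟩
    have hII : IsTypeII (ULift.{u} (ZMod (3 ^ (N + 2)))) := isTypeII_of_card_eq (by omega) hcard
    have hup := hN (ULift.{u} (ZMod (3 ^ (N + 2)))) (by
      rw [hcard]
      have := Nat.lt_pow_self (n := N + 2) (show 1 < 3 by norm_num)
      omega)
    have hlow := three_rpow_le_fMax hII (by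
      rw [hcard, pow_add]
      exact dvd_mul_left _ _)
    have hmu := three_mul_muSumFree_eq hII
    have hmu0 : (0 : ℝ) < muSumFree (ULift.{u} (ZMod (3 ^ (N + 2)))) := by
      have : 0 < 3 ^ (N + 2) := by positivity
      have : 0 < muSumFree (ULift.{u} (ZMod (3 ^ (N + 2)))) := by omega
      exact_mod_cast this
    set m : ℝ := (muSumFree (ULift.{u} (ZMod (3 ^ (N + 2)))) : ℝ) with hm
    have hle := Real.log_le_log (by positivity) (hlow.trans hup)
    rw [Real.log_rpow (by norm_num), Real.log_rpow (by norm_num)] at hle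
    -- This says (1/2 + 1/100) log 2 < (1/3) log 3, which contradicts `hle`.
    have hlt : 153 * Real.log 2 < 100 * Real.log 3 := by
      have := Real.log_lt_log (by norm_num) (show (2 : ℝ) ^ 153 < 3 ^ 100 by norm_num)
      rw [Real.log_pow, Real.log_pow] at this
      exact_mod_cast this
    nlinarith
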